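/- For a finite Borel measure $\nu$ on $(0,1)$ let $\Lambda$ denote Lebesgue measure and let $$\mathcal E_\nu(f,g)=\int_{(0,1)}\nabla f\,\nabla g\,\mathrm d\Lambda$$ be the form whose domain consists of all $f\in H_0^1(0,1)$ (functions $f$ on $[0,1]$ with $f(0)=f(1)=0$ and $f(x)=\int_0^x\nabla f\,\mathrm d\Lambda$ for some $\nabla f\in L^2_\Lambda$) that are affine linear on every connected component of $[0,1]\setminus\operatorname{supp}\nu$. A function $f\neq0$ in the domain is an eigenfunction with eigenvalue $\lambda$ if $\mathcal E_\nu(f,g)=\lambda\int fg\,\mathrm d\nu$ for all $g$ in the domain. Let $N_\nu(x)$ be the number of eigenvalues (counted with multiplicity) not exceeding $x$, and, with the convention $\log 0=-\infty$, let $$\underline s_\nu=\liminf_{x\to\infty}\frac{\log N_\nu(x)}{\log x},\qquad \overline s_\nu=\limsup_{x\to\infty}\frac{\log N_\nu(x)}{\log x}$$ be the lower and upper spectral dimension of $\nu$; if they coincide, the common value is the spectral dimension of $\nu$. Let $\mathcal N^R_\nu(x)$ be the least cardinality of a finite partition of $(0,1]$ into intervals $(c_k,c_{k+1}]$, with no $c_k$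 an atom of $\nu$, such that $\nu(C)\Lambda(C)<1/x$ for every member $C$. For $m>1$ let $\mathcal N^L_{m,\nu}(x)$ be the largest cardinality of a finite disjoint collection of subintervals $C$ of $[0,1]$, with no atoms of $\nu$ at their endpoints, such that $\nu(\langle C\rangle_m)\Lambda(\langle C\rangle_m)\ge\frac{4}{x(m-1)}$ for each $C$, where $\langle C\rangle_m$ is the closed interval of length $\Lambda(C)/m$ centred in $C$. The measure $\nu$ is called regular if $$\sup_{m>1}\liminf_{x\to\infty}\frac{\log\mathcal N^L_{m,\nu}(x)}{\log x}=\limsup_{x\to\infty}\frac{\log\mathcal N^R_\nu(x)}{\log x}.$$ For $\alpha>0$ let $\mathcal N_{\alpha,\nu}(n)$ be the number of $0\le k<2^n$ with $\nu\big((k2^{-n},(k+1)2^{-n}]\big)\ge2^{-\alpha n}$. The measure $\nu$ is called MF-regular if $$\sup_{\alpha>0}\frac1{1+\alpha}\liminf_{n\to\infty}\frac{\log^+\mathcal N_{\alpha,\nu}(n)}{\log2^n}=\sup_{\alpha>0}\frac1{1+\alpha}\limsup_{n\to\infty}\frac{\log^+\mathcal N_{\alpha,\nu}(n)}{\log2^n}.$$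 **Corollary.** Let $\nu_1,\nu_2$ be finite Borel measures on $(0,1)$. Then $$\overline s_{\nu_1+\nu_2}=\max\{\overline s_{\nu_1},\overline s_{\nu_2}\}.$$ If additionally $\underline s_{\nu_1}=\overline s_{\nu_1}\ge\overline s_{\nu_2}$, then the spectral dimension of $\nu_1+\nu_2$ exists and equals $\overline s_{\nu_1}$. If $\underline s_{\nu_1}=\overline s_{\nu_1}\ge\overline s_{\nu_2}$ and $\nu_1$ is regular, then $\nu_1+\nu_2$ is regular; likewise, if $\underline s_{\nu_1}=\overline s_{\nu_1}\ge\overline s_{\nu_2}$ and $\nu_1$ is MF-regular, then $\nu_1+\nu_2$ is MF-regular. -/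

import Mathlib

open MeasureTheory Set Filter
open scoped ENNReal

namespace KreinFeller

noncomputable section

/-!
Functions on the ambient interval `[0, 1]` are represented by functions `ℝ → ℝ` which vanish
outside `[0, 1]`. A Borel measure on `(0, 1)` is a Borel measure on `ℝ` for which the complement of
`(0, 1)` is a null set.
-/

/-- `g` is a weak derivative of `f` on `[0, 1]`: `g ∈ L²([0, 1])` with respect to Lebesgue measure
and `f x = f 0 + ∫_{[0, x]} g` for all `x ∈ [0, 1]`. -/
def IsWeakDeriv (f g : ℝ → ℝ) : Prop :=
  MemLp g 2 (volume.restrict (Icc (0 : ℝ) 1)) ∧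
    ∀ x ∈ Icc (0 : ℝ) 1, f x = f 0 + ∫ t in Icc 0 x, g t

/-- The Sobolev space `H¹₀(0, 1)`: functions with a weak derivative in `L²` vanishing at `0` and
`1` (and, by the above convention, outside `[0, 1]`). -/
def MemH10 (f : ℝ → ℝ) : Prop :=
  (∃ g, IsWeakDeriv f g) ∧ f 0 = 0 ∧ f 1 = 0 ∧ ∀ x ∉ Icc (0 : ℝ) 1, f x = 0

open Classical in
/-- The weak derivative `∇f` (unique up to Lebesgue null sets), if there is one. -/
def weakDeriv (f : ℝ → ℝ) : ℝ → ℝ :=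
  if h : ∃ g, IsWeakDeriv f g then h.choose else 0

/-- The space `C_ν([0, 1])` of functions which are continuous on `[0, 1]` and affine linear on each
connected component of `[0, 1] \ supp ν`. -/
def MemCnu (ν : Measure ℝ) (f : ℝ → ℝ) : Prop :=
  ContinuousOn f (Icc 0 1) ∧
    ∀ y ∈ Icc (0 : ℝ) 1 \ ν.support, ∃ p q : ℝ,
      ∀ z ∈ connectedComponentIn (Icc (0 : ℝ) 1 \ ν.support) y, f z = p * z + q

/-- The Dirichlet domain `dom(𝓔_ν) = H¹₀(0, 1) ∩ C_ν([0, 1])`. -/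
def MemDom (ν : Measure ℝ) (f : ℝ → ℝ) : Prop :=
  MemH10 f ∧ MemCnu ν f

/-- The form `𝓔_ν(f, g) = ∫_{(0, 1)} ∇f ∇g` (with respect to Lebesgue measure). -/
def energy (f g : ℝ → ℝ) : ℝ :=
  ∫ t in Ioo (0 : ℝ) 1, weakDeriv f t * weakDeriv g t

/-- `f` is an eigenfunction of `𝓔_ν` with eigenvalue `l`. -/
def IsEigenfunction (ν : Measure ℝ) (l : ℝ) (f : ℝ → ℝ) : Prop :=
  MemDom ν f ∧ f ≠ 0 ∧ ∀ g, MemDom ν g → energy f g = l * ∫ x, f x * g x ∂ν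

/-- The eigenvalue counting function `N_ν(x)`: the number of eigenvalues of `𝓔_ν` not exceeding
`x`, counted with multiplicity, i.e. the number of linearly independent eigenfunctions with
eigenvalue at most `x`. -/
def eigenvalueCount (ν : Measure ℝ) (x : ℝ) : ℕ∞ :=
  Cardinal.toENat
    (Module.rank ℝ (Submodule.span ℝ {f : ℝ → ℝ | ∃ l ≤ x, IsEigenfunction ν l f}))

/-- `log N(x) / log x` as an extended real number, with `log 0 = -∞`. -/
def logRatio (N : ℝ → ℕ∞) (x : ℝ) : EReal :=
  ENNReal.log (N x : ℝ≥0∞) / ((Real.log x : ℝ) : EReal)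

/-- The lower spectral dimension of `ν`. -/
def lowerSpectralDim (ν : Measure ℝ) : EReal :=
  liminf (logRatio (eigenvalueCount ν)) atTop

/-- The upper spectral dimension of `ν`. -/
def upperSpectralDim (ν : Measure ℝ) : EReal :=
  limsup (logRatio (eigenvalueCount ν)) atTop

/-- The points `0 = c 0 < c 1 < ... < c n = 1`, none of which is an atom of `ν`, determine the
`ν`-partition of `[0, 1]` into the `n` intervals `(c k, c (k + 1)]`. -/
def IsNuPartition (ν : Measure ℝ) {n : ℕ} (c : Fin (n + 1) → ℝ) : Prop :=
  StrictMono c ∧ c 0 = 0 ∧ c (Fin.last n) = 1 ∧ ∀ k, ν {c k} = 0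

/-- The least cardinality of a `ν`-partition all of whose members `C` satisfy
`ν(C) Λ(C) < 1 / x`, where `Λ` is Lebesgue measure. -/
def partitionCount (ν : Measure ℝ) (x : ℝ) : ℕ∞ :=
  ⨅ (n : ℕ) (_ : ∃ c : Fin (n + 1) → ℝ, IsNuPartition ν c ∧
    ∀ k : Fin n, ν.real (Ioc (c k.castSucc) (c k.succ)) * (c k.succ - c k.castSucc) < 1 / x),
    (n : ℕ∞)

/-- The upper `ν`-partition entropy. -/
def upperEntropy (ν : Measure ℝ) : EReal :=
  limsup (logRatio (partitionCount ν)) atTop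

/-- The closed interval of length `(b - a) / m` with the same centre as the interval from `a` to
`b`. -/
def core (m a b : ℝ) : Set ℝ :=
  Icc ((a + b) / 2 - (b - a) / (2 * m)) ((a + b) / 2 + (b - a) / (2 * m))

/-- The largest cardinality of a finite disjoint collection of subintervals `C` of `[0, 1]` without
atoms of `ν` at their endpoints such that `ν(⟨C⟩) Λ(⟨C⟩) ≥ 4 / (x (m - 1))`, where `⟨C⟩` is the
interval of length `Λ(C) / m` centred in `C`. -/
def packingCount (ν : Measure ℝ) (m x : ℝ) : ℕ∞ :=
  ⨆ (n : ℕ) (_ : ∃ a b : Fin n → ℝ,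
    (∀ k, 0 ≤ a k ∧ a k < b k ∧ b k ≤ 1 ∧ ν {a k} = 0 ∧ ν {b k} = 0) ∧
    Pairwise (fun j k => Disjoint (Ioo (a j) (b j)) (Ioo (a k) (b k))) ∧
    ∀ k, 4 / (x * (m - 1)) ≤ ν.real (core m (a k) (b k)) * ((b k - a k) / m)),
    (n : ℕ∞)

/-- The lower `m`-reduced `ν`-partition entropy. -/
def lowerReducedEntropy (ν : Measure ℝ) (m : ℝ) : EReal :=
  liminf (logRatio (packingCount ν m)) atTop

/-- `ν` is regular: the supremum over `m > 1` of its lower `m`-reduced partition entropies equals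
its upper partition entropy. -/
def IsRegular (ν : Measure ℝ) : Prop :=
  (⨆ (m : ℝ) (_ : 1 < m), lowerReducedEntropy ν m) = upperEntropy ν

/-- The number of dyadic intervals `(k 2⁻ⁿ, (k + 1) 2⁻ⁿ]`, `0 ≤ k < 2ⁿ`, of `ν`-measure at least
`2^(-α n)`. -/
def dyadicCount (ν : Measure ℝ) (α : ℝ) (n : ℕ) : ℕ :=
  {k : ℕ | k < 2 ^ n ∧
    (2 : ℝ) ^ (-α * n) ≤ ν.real (Ioc ((k : ℝ) / 2 ^ n) (((k : ℝ) + 1) / 2 ^ n))}.ncard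

/-- `log⁺ (dyadicCount ν α n) / log 2ⁿ`. -/
def dyadicRatio (ν : Measure ℝ) (α : ℝ) (n : ℕ) : EReal :=
  ((Real.posLog (dyadicCount ν α n) / Real.log (2 ^ n) : ℝ) : EReal)

/-- The lower optimized coarse multifractal dimension. -/
def lowerMFDim (ν : Measure ℝ) : EReal :=
  ⨆ (α : ℝ) (_ : 0 < α), liminf (dyadicRatio ν α) atTop / ((1 + α : ℝ) : EReal)

/-- The upper optimized coarse multifractal dimension. -/
def upperMFDim (ν : Measure ℝ) : EReal :=
  ⨆ (α : ℝ) (_ : 0 < α), limsup (dyadicRatio ν α) atTop / ((1 + α : ℝ) : EReal)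

/-- `ν` is MF-regular: its lower and upper optimized coarse multifractal dimensions coincide. -/
def IsMFRegular (ν : Measure ℝ) : Prop :=
  lowerMFDim ν = upperMFDim ν

end

end KreinFeller

/-!
Passing from `f` to its derivative, the inverse of the form `𝓔_ν` with respect to `ν` becomes the
positive compact operator `T_ν = ∫ b_x ⊗ b_x dν(x)` on `L²(0, 1)`, where `⟪b_x, b_y⟫` is the Green
function of the Dirichlet Laplacian. Hence `N_ν(x)` counts the eigenvalues of `T_ν` that are at
least `1 / x`. Since `T_{ν₁ + ν₂} = T_{ν₁} + T_{ν₂}`, the min-max principle gives monotonicity of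
`N` in the measure and Weyl's inequality `N_{ν₁ + ν₂}(x) ≤ N_{ν₁}(2 x) + N_{ν₂}(2 x)`, and with
them the formula for the upper spectral dimension.

Trapezoidal test functions bound packing counts by `N_ν`, and functions vanishing at the partition
points show that `N_ν` is at most the partition count. Halving dyadic intervals until
`ν(C) Λ(C) < t` bounds the upper partition entropy by the upper multifractal dimension, and
trapezoids over tripled dyadic intervals bound the latter by the upper spectral dimension (or `0`).
All upper quantities thus agree once negative values are replaced by `0`, while the lower ones are
monotone in the measure, so each kind of regularity passes from `ν₁` to every larger measure with
the same upper spectral dimension.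
-/

open scoped InnerProductSpace Topology

namespace KreinFeller

section SpectralCounting

variable {𝕜 E : Type*} [RCLike 𝕜] [NormedAddCommGroup E] [InnerProductSpace 𝕜 E]

/-- The sum of the eigenspaces of `T` to real eigenvalues at least `s`. -/
def upperEigenspace (T : E →L[𝕜] E) (s : ℝ) : Submodule 𝕜 E :=
  ⨆ μ : Ici s, Module.End.eigenspace (T : E →ₗ[𝕜] E) ((μ : ℝ) : 𝕜)

/-- The number of real eigenvalues of `T` that are at least `s`, counted with multiplicity. -/
noncomputable def spectralCount (T : E →L[𝕜] E) (s : ℝ) : ℕ∞ :=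
  Cardinal.toENat (Module.rank 𝕜 (upperEigenspace T s))

theorem reApplyInnerSelf_sum {ι : Type*} {T : E →L[𝕜] E} {u : Finset ι} {v : ι → E}
    (h : (u : Set ι).Pairwise fun i j => ⟪T (v i), v j⟫_𝕜 = 0) :
    T.reApplyInnerSelf (∑ i ∈ u, v i) = ∑ i ∈ u, T.reApplyInnerSelf (v i) := by
  simp only [ContinuousLinearMap.reApplyInnerSelf_apply, map_sum, sum_inner, inner_sum]
  refine Finset.sum_congr rfl fun i hi => Finset.sum_eq_single i (fun j hj hij => ?_) (absurd hi)
  rw [h hj hi hij, map_zero]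

theorem reApplyInnerSelf_id (x : E) :
    (ContinuousLinearMap.id 𝕜 E).reApplyInnerSelf x = ‖x‖ ^ 2 := by
  rw [ContinuousLinearMap.reApplyInnerSelf_apply, ContinuousLinearMap.id_apply,
    inner_self_eq_norm_sq]

theorem mul_norm_sq_sum_le_reApplyInnerSelf {ι : Type*} {T : E →L[𝕜] E} {s : ℝ} {u : Finset ι}
    {v : ι → E} (horth : (u : Set ι).Pairwise fun i j => ⟪v i, v j⟫_𝕜 = 0)
    (hTorth : (u : Set ι).Pairwise fun i j => ⟪T (v i), v j⟫_𝕜 = 0)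
    (hv : ∀ i ∈ u, s * ‖v i‖ ^ 2 ≤ T.reApplyInnerSelf (v i)) :
    s * ‖∑ i ∈ u, v i‖ ^ 2 ≤ T.reApplyInnerSelf (∑ i ∈ u, v i) := by
  rw [← reApplyInnerSelf_id (𝕜 := 𝕜), reApplyInnerSelf_sum horth, reApplyInnerSelf_sum hTorth,
    Finset.mul_sum]
  simp only [reApplyInnerSelf_id]
  exact Finset.sum_le_sum hv

theorem mul_norm_sq_le_reApplyInnerSelf {T : E →L[𝕜] E} (hT : T.IsSymmetric) {s : ℝ} {g : E}
    (hg : g ∈ upperEigenspace T s) : s * ‖g‖ ^ 2 ≤ T.reApplyInnerSelf g := by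
  obtain ⟨v, hv, rfl⟩ := (Submodule.mem_iSup_iff_exists_finsupp _ _).1 hg
  have hTv (i : Ici s) : T (v i) = ((i : ℝ) : 𝕜) • v i := Module.End.mem_eigenspace_iff.1 (hv i)
  have horth (i j : Ici s) (hij : i ≠ j) : ⟪v i, v j⟫_𝕜 = 0 :=
    (hT.orthogonalFamily_eigenspaces.isOrtho fun h =>
      hij (Subtype.ext (RCLike.ofReal_injective h))).inner_eq (hv i) (hv j)
  refine mul_norm_sq_sum_le_reApplyInnerSelf (fun i _ j _ hij => horth i j hij)
    (fun i _ j _ hij => ?_) fun i _ => ?_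
  · simp only [hTv, inner_smul_left, horth i j hij, mul_zero]
  · rw [ContinuousLinearMap.reApplyInnerSelf_apply, hTv, inner_smul_left, RCLike.conj_ofReal,
      RCLike.re_ofReal_mul, inner_self_eq_norm_sq]
    gcongr
    exact i.2

theorem apply_mem_orthogonal_upperEigenspace {T : E →L[𝕜] E} (hT : T.IsSymmetric) {s : ℝ} {g : E}
    (hg : g ∈ (upperEigenspace T s)ᗮ) : T g ∈ (upperEigenspace T s)ᗮ := by
  rw [upperEigenspace, ← Submodule.iInf_orthogonal, Submodule.mem_iInf] at hg ⊢
  intro μ w hw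
  have hTw : T w = ((μ : ℝ) : 𝕜) • w := Module.End.mem_eigenspace_iff.1 hw
  calc ⟪w, T g⟫_𝕜 = ⟪T w, g⟫_𝕜 := (hT w g).symm
    _ = 0 := by rw [hTw, inner_smul_left, hg μ w hw, mul_zero]

theorem hasEigenvalue_norm [CompleteSpace E] {T : E →L[𝕜] E} (hc : IsCompactOperator T)
    (hT : T.IsPositive) (h0 : T ≠ 0) :
    Module.End.HasEigenvalue (T : E →ₗ[𝕜] E) ((‖T‖ : ℝ) : 𝕜) := by
  have : Nontrivial E := by
    by_contra! h
    exact h0 (Subsingleton.elim _ _)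
  refine (hc.hasEigenvalue_iff_mem_spectrum (by simpa using h0)).2 ?_
  by_contra hres
  obtain ⟨ε, hε, hle⟩ := T.rayleighQuotient_le_of_norm_mem_resolventSet (𝕜 := 𝕜)
    (by simpa [spectrum] using hres)
  have hsup : ⨆ x, |T.rayleighQuotient x| ≤ ‖T‖ - ε := ciSup_le fun x => by
    rw [abs_of_nonneg (div_nonneg (hT.2 x) (sq_nonneg _))]
    exact hle x
  rw [← T.norm_eq_iSup_rayleighQuotient hT.isSymmetric] at hsup
  linarith

theorem norm_restrict_orthogonal_upperEigenspace_lt [CompleteSpace E] {T : E →L[𝕜] E}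
    (hc : IsCompactOperator T) (hT : T.IsPositive) {s : ℝ} (hs : 0 < s) :
    ‖T.restrict (p := (upperEigenspace T s)ᗮ)
      fun _ => apply_mem_orthogonal_upperEigenspace hT.isSymmetric‖ < s := by
  set W := upperEigenspace T s
  set S := T.restrict (p := Wᗮ) fun _ => apply_mem_orthogonal_upperEigenspace hT.isSymmetric
  by_contra! hle
  have hSpos : S.IsPositive :=
    ⟨hT.isSymmetric.restrict_invariant fun _ => apply_mem_orthogonal_upperEigenspace hT.isSymmetric,
      fun v => hT.2 v⟩
  obtain ⟨v, hv, hv0⟩ := (hasEigenvalue_norm (hc.restrict' fun _ =>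
    apply_mem_orthogonal_upperEigenspace hT.isSymmetric) hSpos
    (norm_pos_iff.1 (hs.trans_le hle))).exists_hasEigenvector
  have hTv : T (v : E) = ((‖S‖ : ℝ) : 𝕜) • (v : E) :=
    congrArg Subtype.val (Module.End.mem_eigenspace_iff.1 hv)
  have hvW : (v : E) ∈ W :=
    Submodule.mem_iSup_of_mem ⟨‖S‖, hle⟩ (Module.End.mem_eigenspace_iff.2 hTv)
  exact hv0 (Subtype.ext (inner_self_eq_zero.1 (v.2 v hvW)))

theorem reApplyInnerSelf_lt [CompleteSpace E] {T : E →L[𝕜] E} (hc : IsCompactOperator T)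
    (hT : T.IsPositive) {s : ℝ} (hs : 0 < s) {g : E} (hg : g ∈ (upperEigenspace T s)ᗮ)
    (hg0 : g ≠ 0) : T.reApplyInnerSelf g < s * ‖g‖ ^ 2 := by
  set S := T.restrict (p := (upperEigenspace T s)ᗮ)
    fun _ => apply_mem_orthogonal_upperEigenspace hT.isSymmetric
  have : 0 < ‖g‖ := norm_pos_iff.2 hg0
  calc T.reApplyInnerSelf g ≤ ‖T g‖ * ‖g‖ := re_inner_le_norm _ _
    _ ≤ ‖S‖ * ‖g‖ * ‖g‖ := by gcongr; exact S.le_opNorm ⟨g, hg⟩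
    _ < s * ‖g‖ * ‖g‖ := by
      gcongr
      exact norm_restrict_orthogonal_upperEigenspace_lt hc hT hs
    _ = s * ‖g‖ ^ 2 := by ring

theorem toENat_rank_le_of_inf_orthogonal_eq_bot {A B : Submodule 𝕜 E} (h : A ⊓ Bᗮ = ⊥) :
    Cardinal.toENat (Module.rank 𝕜 A) ≤ Cardinal.toENat (Module.rank 𝕜 B) := by
  rcases lt_or_ge (Module.rank 𝕜 B) Cardinal.aleph0 with hB | hB
  · have : FiniteDimensional 𝕜 B := Module.rank_lt_aleph0_iff.1 hB
    refine Cardinal.toENat.monotone' (LinearMap.rank_le_of_injective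
      ((B.orthogonalProjectionOnto : E →ₗ[𝕜] B).comp A.subtype)
      ((injective_iff_map_eq_zero _).2 fun a ha => Subtype.ext ?_))
    have hmem : (a : E) ∈ A ⊓ Bᗮ := ⟨a.2, Submodule.orthogonalProjectionOnto_eq_zero_iff.1 ha⟩
    rwa [h, Submodule.mem_bot] at hmem
  · rw [Cardinal.toENat_eq_top.2 hB]
    exact le_top

theorem toENat_rank_sup_le (A B : Submodule 𝕜 E) :
    Cardinal.toENat (Module.rank 𝕜 (A ⊔ B : Submodule 𝕜 E)) ≤
      Cardinal.toENat (Module.rank 𝕜 A) + Cardinal.toENat (Module.rank 𝕜 B) := by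
  rw [← map_add]
  exact Cardinal.toENat.monotone' (Submodule.rank_add_le_rank_add_rank A B)

theorem spectralCount_le_finrank {F : Type*} [AddCommGroup F] [Module 𝕜 F]
    [FiniteDimensional 𝕜 F] {T : E →L[𝕜] E} (hT : T.IsSymmetric) {s : ℝ} (L : E →ₗ[𝕜] F)
    (hL : ∀ g ∈ upperEigenspace T s, L g = 0 → g ≠ 0 → T.reApplyInnerSelf g < s * ‖g‖ ^ 2) :
    spectralCount T s ≤ Module.finrank 𝕜 F := by
  have hinj : Function.Injective (L.comp (upperEigenspace T s).subtype) :=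
    (injective_iff_map_eq_zero _).2 fun g hg => by
      by_contra h0
      exact (hL g g.2 hg (by simpa using h0)).not_ge (mul_norm_sq_le_reApplyInnerSelf hT g.2)
  have : FiniteDimensional 𝕜 (upperEigenspace T s) := FiniteDimensional.of_injective _ hinj
  rw [spectralCount, ← Module.finrank_eq_rank, Cardinal.toENat_nat]
  exact_mod_cast LinearMap.finrank_le_finrank_of_injective hinj

variable [CompleteSpace E]

theorem toENat_rank_le_spectralCount {T : E →L[𝕜] E} (hc : IsCompactOperator T)
    (hT : T.IsPositive) {s : ℝ} (hs : 0 < s) {V : Submodule 𝕜 E}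
    (hV : ∀ g ∈ V, s * ‖g‖ ^ 2 ≤ T.reApplyInnerSelf g) :
    Cardinal.toENat (Module.rank 𝕜 V) ≤ spectralCount T s := by
  refine toENat_rank_le_of_inf_orthogonal_eq_bot ((Submodule.eq_bot_iff _).2 fun g hg => ?_)
  by_contra h0
  exact (reApplyInnerSelf_lt hc hT hs hg.2 h0).not_ge (hV g hg.1)

theorem card_le_spectralCount {T : E →L[𝕜] E} (hc : IsCompactOperator T) (hT : T.IsPositive)
    {s : ℝ} (hs : 0 < s) {ι : Type*} [Fintype ι] {v : ι → E} (hv0 : ∀ i, v i ≠ 0)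
    (horth : Pairwise fun i j => ⟪v i, v j⟫_𝕜 = 0)
    (hTorth : Pairwise fun i j => ⟪T (v i), v j⟫_𝕜 = 0)
    (hv : ∀ i, s * ‖v i‖ ^ 2 ≤ T.reApplyInnerSelf (v i)) :
    (Fintype.card ι : ℕ∞) ≤ spectralCount T s := by
  have hli : LinearIndependent 𝕜 v := linearIndependent_of_ne_zero_of_inner_eq_zero hv0 horth
  have : FiniteDimensional 𝕜 (Submodule.span 𝕜 (range v)) :=
    FiniteDimensional.span_of_finite 𝕜 (finite_range v)
  rw [← finrank_span_eq_card hli, ← Cardinal.toENat_nat, Module.finrank_eq_rank]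
  refine toENat_rank_le_spectralCount hc hT hs fun g hg => ?_
  obtain ⟨c, rfl⟩ := (Submodule.mem_span_range_iff_exists_fun 𝕜).1 hg
  refine mul_norm_sq_sum_le_reApplyInnerSelf (fun i _ j _ hij => ?_) (fun i _ j _ hij => ?_)
    fun i _ => ?_
  · simp only [inner_smul_left, inner_smul_right, horth hij, mul_zero]
  · simp only [map_smul, inner_smul_left, inner_smul_right, hTorth hij, mul_zero]
  · rw [ContinuousLinearMap.reApplyInnerSelf_smul, norm_smul, mul_pow, mul_left_comm]
    gcongr
    exact hv i

theorem spectralCount_mono {T₁ T₂ : E →L[𝕜] E} (h₁ : T₁.IsSymmetric) (hc₂ : IsCompactOperator T₂)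
    (h₂ : T₂.IsPositive) (hle : T₁ ≤ T₂) {s : ℝ} (hs : 0 < s) :
    spectralCount T₁ s ≤ spectralCount T₂ s :=
  toENat_rank_le_spectralCount hc₂ h₂ hs fun g hg =>
    (mul_norm_sq_le_reApplyInnerSelf h₁ hg).trans <| by
      have hnonneg : 0 ≤ RCLike.re ⟪(T₂ - T₁) g, g⟫_𝕜 := hle.re_inner_nonneg_left g
      rwa [_root_.sub_apply, inner_sub_left, map_sub, sub_nonneg] at hnonneg

theorem spectralCount_add_le {T₁ T₂ : E →L[𝕜] E} (hc₁ : IsCompactOperator T₁)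
    (hc₂ : IsCompactOperator T₂) (h₁ : T₁.IsPositive) (h₂ : T₂.IsPositive) {s t : ℝ} (hs : 0 < s)
    (ht : 0 < t) :
    spectralCount (T₁ + T₂) (s + t) ≤ spectralCount T₁ s + spectralCount T₂ t := by
  refine le_trans (toENat_rank_le_of_inf_orthogonal_eq_bot
    ((Submodule.eq_bot_iff _).2 fun g hg => ?_)) (toENat_rank_sup_le _ _)
  by_contra h0
  have hgo := hg.2
  rw [← Submodule.inf_orthogonal] at hgo
  have hlt := add_lt_add (reApplyInnerSelf_lt hc₁ h₁ hs hgo.1 h0)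
    (reApplyInnerSelf_lt hc₂ h₂ ht hgo.2 h0)
  have hle := mul_norm_sq_le_reApplyInnerSelf (h₁.add h₂).isSymmetric hg.1
  simp only [ContinuousLinearMap.reApplyInnerSelf_apply, _root_.add_apply, inner_add_left, map_add]
    at hlt hle
  linarith

end SpectralCounting

section FrameOperator

open InnerProductSpace (rankOne)

variable {X E : Type*} [MeasurableSpace X] [NormedAddCommGroup E] [InnerProductSpace ℝ E]
  {μ ν : Measure X} {b : X → E}

/-- The frame operator `∫ b ⊗ b dμ` of the family `b` with respect to `μ`. -/
noncomputable def frameOp (μ : Measure X) (b : X → E) : E →L[ℝ] E :=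
  ∫ x, rankOne ℝ (b x) (b x) ∂μ

theorem integrable_rankOne (hb : MemLp b 2 μ) : Integrable (fun x => rankOne ℝ (b x) (b x)) μ := by
  have hcont : Continuous fun v : E => rankOne ℝ v v :=
    (rankOne ℝ).continuous.clm_apply continuous_id
  refine (integrable_norm_iff (hcont.comp_aestronglyMeasurable hb.1)).1 ?_
  simp only [InnerProductSpace.norm_rankOne, ← sq]
  exact hb.integrable_norm_pow two_ne_zero

theorem frameOp_add_measure (hμ : MemLp b 2 μ) (hν : MemLp b 2 ν) :
    frameOp (μ + ν) b = frameOp μ b + frameOp ν b :=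
  integral_add_measure (integrable_rankOne hμ) (integrable_rankOne hν)

theorem isCompactOperator_rankOne (x y : E) : IsCompactOperator (rankOne ℝ x y) := by
  have h : IsCompactOperator (ContinuousLinearMap.toSpanSingleton ℝ x) :=
    isCompactOperator_of_locallyCompactSpace_rng _
  rw [InnerProductSpace.rankOne_def']
  exact h.comp_clm _

theorem frameOp_apply (hb : MemLp b 2 μ) (g : E) : frameOp μ b g = ∫ x, ⟪b x, g⟫_ℝ • b x ∂μ :=
  ContinuousLinearMap.integral_apply (integrable_rankOne hb) g

variable [CompleteSpace E]

theorem inner_frameOp (hb : MemLp b 2 μ) (g h : E) :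
    ⟪h, frameOp μ b g⟫_ℝ = ∫ x, ⟪b x, g⟫_ℝ * ⟪b x, h⟫_ℝ ∂μ := by
  have hint : Integrable (fun x => ⟪b x, g⟫_ℝ • b x) μ :=
    (integrable_rankOne hb).apply_continuousLinearMap g
  rw [frameOp_apply hb, ← integral_inner hint]
  simp only [real_inner_smul_right, real_inner_comm h]

theorem reApplyInnerSelf_frameOp (hb : MemLp b 2 μ) (g : E) :
    (frameOp μ b).reApplyInnerSelf g = ∫ x, ⟪b x, g⟫_ℝ ^ 2 ∂μ := by
  rw [ContinuousLinearMap.reApplyInnerSelf_apply, real_inner_comm, inner_frameOp hb]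
  simp only [sq, RCLike.re_to_real]

theorem isPositive_frameOp (hb : MemLp b 2 μ) : (frameOp μ b).IsPositive := by
  refine ⟨fun g h => ?_, fun g => ?_⟩
  · rw [ContinuousLinearMap.coe_coe, real_inner_comm, inner_frameOp hb, inner_frameOp hb]
    simp only [mul_comm]
  · rw [reApplyInnerSelf_frameOp hb]
    exact integral_nonneg fun x => sq_nonneg _

theorem frameOp_mono (hν : MemLp b 2 ν) (hle : μ ≤ ν) : frameOp μ b ≤ frameOp ν b := by
  have hμ : MemLp b 2 μ := hν.mono_measure hle
  refine ⟨(isPositive_frameOp hν).isSymmetric.sub (isPositive_frameOp hμ).isSymmetric, fun g => ?_⟩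
  have hint : Integrable (fun x => ⟪b x, g⟫_ℝ ^ 2) ν := (hν.inner_const g).integrable_sq
  have hmono := integral_mono_measure hle (ae_of_all _ fun x => sq_nonneg ⟪b x, g⟫_ℝ) hint
  rwa [← reApplyInnerSelf_frameOp hμ, ← reApplyInnerSelf_frameOp hν, ← sub_nonneg,
    ContinuousLinearMap.reApplyInnerSelf_apply, ContinuousLinearMap.reApplyInnerSelf_apply,
    ← map_sub, ← inner_sub_left, ← _root_.sub_apply] at hmono

theorem isCompactOperator_frameOp [IsFiniteMeasure μ] (hb : MemLp b 2 μ) :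
    IsCompactOperator (frameOp μ b) := by
  let K := compactOperator (RingHom.id ℝ) E E
  have hK : IsClosed (K : Set (E →L[ℝ] E)) := isClosed_setOfPred_isCompactOperator
  change frameOp μ b ∈ K
  rcases eq_or_ne μ 0 with rfl | hμ
  · rw [frameOp, integral_zero_measure]
    exact K.zero_mem
  · have : NeZero μ := ⟨hμ⟩
    rw [frameOp, ← measure_smul_average]
    exact K.smul_mem _ (Convex.average_mem K.convex hK
      (ae_of_all _ fun x => isCompactOperator_rankOne (b x) (b x)) (integrable_rankOne hb))

end FrameOperator

/-- Lebesgue measure on `[0, 1]`. -/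
noncomputable abbrev unitVolume : Measure ℝ := volume.restrict (Icc (0 : ℝ) 1)

/-- The Hilbert space `L²([0, 1])`. -/
abbrev L2Unit : Type := Lp ℝ 2 unitVolume

/-- The indicator function of `(0, x]`. -/
noncomputable def stepFun (x : ℝ) : L2Unit :=
  indicatorConstLp 2 (measurableSet_Ioc : MeasurableSet (Ioc (0 : ℝ) x))
    (measure_ne_top unitVolume _) (1 : ℝ)

theorem continuous_stepFun : Continuous stepFun := by
  refine continuous_indicatorConstLp_set ENNReal.ofNat_ne_top fun x => ?_
  have hsub (y : ℝ) : symmDiff (Ioc 0 y) (Ioc 0 x) ⊆ uIcc x y := by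
    intro t
    simp only [mem_symmDiff, mem_Ioc, mem_uIcc]
    grind
  have hlim : Tendsto (fun y => ENNReal.ofReal |y - x|) (𝓝 x) (𝓝 0) := by
    have h : Continuous fun y => ENNReal.ofReal |y - x| :=
      ENNReal.continuous_ofReal.comp (by fun_prop)
    simpa using h.tendsto x
  refine tendsto_of_tendsto_of_tendsto_of_le_of_le tendsto_const_nhds hlim (fun _ => zero_le)
    fun y => ?_
  calc unitVolume (symmDiff (Ioc 0 y) (Ioc 0 x)) ≤ volume (uIcc x y) :=
        (Measure.restrict_apply_le _ _).trans (measure_mono (hsub y))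
    _ = ENNReal.ofReal |y - x| := Real.volume_interval

theorem inner_stepFun {x : ℝ} (hx : x ≤ 1) (g : L2Unit) :
    ⟪stepFun x, g⟫_ℝ = ∫ t in Ioc 0 x, g t := by
  rw [stepFun, L2.inner_indicatorConstLp_one, Measure.restrict_restrict measurableSet_Ioc,
    inter_eq_left.2 (Ioc_subset_Icc_self.trans (Icc_subset_Icc le_rfl hx))]

theorem inner_stepFun_stepFun {x y : ℝ} (hx : x ∈ Icc (0 : ℝ) 1) (hy : y ∈ Icc (0 : ℝ) 1) :
    ⟪stepFun x, stepFun y⟫_ℝ = min x y := by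
  have hinter : Ioc 0 x ∩ Ioc 0 y ∩ Icc (0 : ℝ) 1 = Ioc 0 (min x y) := by
    rw [Ioc_inter_Ioc, max_self, inter_eq_left]
    exact Ioc_subset_Icc_self.trans (Icc_subset_Icc le_rfl ((min_le_left _ _).trans hx.2))
  rw [stepFun, stepFun, L2.inner_indicatorConstLp_one_indicatorConstLp_one measurableSet_Ioc
    measurableSet_Ioc, measureReal_restrict_apply (measurableSet_Ioc.inter measurableSet_Ioc),
    hinter, Real.volume_real_Ioc_of_le (le_min hx.1 hy.1), sub_zero]
  rfl

theorem inner_stepFun_one_stepFun {x : ℝ} (hx : x ∈ Icc (0 : ℝ) 1) :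
    ⟪stepFun 1, stepFun x⟫_ℝ = x := by
  rw [inner_stepFun_stepFun (right_mem_Icc.2 zero_le_one) hx, min_eq_right hx.2]

theorem stepFun_of_nonpos {x : ℝ} (hx : x ≤ 0) : stepFun x = 0 := by
  simp only [stepFun, Ioc_eq_empty hx.not_gt, indicatorConstLp_empty]

theorem stepFun_of_one_le {x : ℝ} (hx : 1 ≤ x) : stepFun x = stepFun 1 := by
  refine (indicatorConstLp_inj _ _ _ _ one_ne_zero).2 ?_
  filter_upwards [ae_restrict_mem measurableSet_Icc] with t ht
  exact propext ⟨fun h => ⟨h.1, ht.2⟩, fun h => ⟨h.1, h.2.trans hx⟩⟩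

/-- The projection of `stepFun x` onto the functions with mean zero. -/
noncomputable def bridge (x : ℝ) : L2Unit := stepFun x - ⟪stepFun 1, stepFun x⟫_ℝ • stepFun 1

theorem continuous_bridge : Continuous bridge :=
  continuous_stepFun.sub
    ((Continuous.inner (𝕜 := ℝ) continuous_const continuous_stepFun).smul continuous_const)

theorem inner_stepFun_one_bridge (x : ℝ) : ⟪stepFun 1, bridge x⟫_ℝ = 0 := by
  rw [bridge, inner_sub_right, real_inner_smul_right,
    inner_stepFun_one_stepFun (right_mem_Icc.2 zero_le_one), mul_one, sub_self]

theorem bridge_of_mem {x : ℝ} (hx : x ∈ Icc (0 : ℝ) 1) :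
    bridge x = stepFun x - x • stepFun 1 := by
  rw [bridge, inner_stepFun_one_stepFun hx]

theorem bridge_eq_zero {x : ℝ} (hx : x ∉ Ioo (0 : ℝ) 1) : bridge x = 0 := by
  rcases le_or_gt x 0 with h0 | h0
  · rw [bridge, stepFun_of_nonpos h0, inner_zero_right, zero_smul, sub_zero]
  · have h1 : 1 ≤ x := not_lt.1 fun h1 => hx ⟨h0, h1⟩
    rw [bridge, stepFun_of_one_le h1, inner_stepFun_one_stepFun (right_mem_Icc.2 zero_le_one),
      one_smul, sub_self]

-- Green's function of `-d²/dx²` on `[0, 1]` with Dirichlet boundary conditions.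
theorem inner_bridge_bridge {x y : ℝ} (hx : x ∈ Icc (0 : ℝ) 1) (hy : y ∈ Icc (0 : ℝ) 1) :
    ⟪bridge x, bridge y⟫_ℝ = min x y - x * y := by
  rw [bridge_of_mem hx, inner_sub_left, real_inner_smul_left, inner_stepFun_one_bridge,
    bridge_of_mem hy, inner_sub_right, real_inner_smul_right, inner_stepFun_stepFun hx hy,
    real_inner_comm, inner_stepFun_one_stepFun hx]
  ring

theorem norm_bridge_le (x : ℝ) : ‖bridge x‖ ≤ 1 := by
  by_cases hx : x ∈ Ioo (0 : ℝ) 1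
  · have h := inner_bridge_bridge (Ioo_subset_Icc_self hx) (Ioo_subset_Icc_self hx)
    rw [real_inner_self_eq_norm_sq, min_self] at h
    nlinarith [hx.1, hx.2, norm_nonneg (bridge x)]
  · rw [bridge_eq_zero hx, norm_zero]
    exact zero_le_one

theorem memLp_bridge (ν : Measure ℝ) [IsFiniteMeasure ν] : MemLp bridge 2 ν :=
  MemLp.of_bound continuous_bridge.aestronglyMeasurable 1 (ae_of_all _ norm_bridge_le)

/-- The primitive of `g - ∫ g` vanishing at `0` and `1`, extended by `0` outside `[0, 1]`. -/
noncomputable def primitive : L2Unit →ₗ[ℝ] ℝ → ℝ :=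
  LinearMap.pi fun x => (innerSL ℝ (bridge x) : L2Unit →ₗ[ℝ] ℝ)

theorem primitive_apply (g : L2Unit) (x : ℝ) : primitive g x = ⟪bridge x, g⟫_ℝ := rfl

theorem continuous_primitive (g : L2Unit) : Continuous (primitive g) :=
  continuous_bridge.inner continuous_const

theorem primitive_eq_zero (g : L2Unit) {x : ℝ} (hx : x ∉ Ioo (0 : ℝ) 1) : primitive g x = 0 := by
  rw [primitive_apply, bridge_eq_zero hx, inner_zero_left]

theorem primitive_of_mem {g : L2Unit} (hg : ⟪stepFun 1, g⟫_ℝ = 0) {x : ℝ}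
    (hx : x ∈ Icc (0 : ℝ) 1) : primitive g x = ∫ t in Ioc 0 x, g t := by
  rw [primitive_apply, bridge_of_mem hx, inner_sub_left, real_inner_smul_left, hg,
    inner_stepFun hx.2, mul_zero, sub_zero]

theorem memLp_primitive (ν : Measure ℝ) [IsFiniteMeasure ν] (g : L2Unit) :
    MemLp (primitive g) 2 ν :=
  (memLp_bridge ν).inner_const g

/-- The solution operator of the Krein–Feller eigenvalue problem, written in terms of derivatives:
with `J = primitive` it is characterised by `⟪T g, h⟫ = ∫ Jg Jh dν`. -/
noncomputable def greenOp (ν : Measure ℝ) : L2Unit →L[ℝ] L2Unit := frameOp ν bridge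

section GreenOp

variable (ν : Measure ℝ) [IsFiniteMeasure ν]

theorem inner_greenOp (g h : L2Unit) :
    ⟪h, greenOp ν g⟫_ℝ = ∫ x, primitive g x * primitive h x ∂ν :=
  inner_frameOp (memLp_bridge ν) g h

theorem reApplyInnerSelf_greenOp (g : L2Unit) :
    (greenOp ν).reApplyInnerSelf g = ∫ x, primitive g x ^ 2 ∂ν :=
  reApplyInnerSelf_frameOp (memLp_bridge ν) g

theorem isPositive_greenOp : (greenOp ν).IsPositive := isPositive_frameOp (memLp_bridge ν)

theorem isCompactOperator_greenOp : IsCompactOperator (greenOp ν) :=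
  isCompactOperator_frameOp (memLp_bridge ν)

theorem inner_stepFun_one_greenOp (g : L2Unit) : ⟪stepFun 1, greenOp ν g⟫_ℝ = 0 := by
  have hprim (x : ℝ) : primitive (stepFun 1) x = 0 := by
    rw [primitive_apply, real_inner_comm, inner_stepFun_one_bridge]
  simp only [inner_greenOp, hprim, mul_zero, integral_zero]

end GreenOp

section Correspondence

theorem ae_eq_zero_of_setIntegral_Icc_eq_zero {h : ℝ → ℝ} {a b : ℝ} (hab : a ≤ b)
    (hi : IntegrableOn h (Icc a b)) (h0 : ∀ x ∈ Icc a b, ∫ t in Icc a x, h t = 0) :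
    h =ᵐ[volume.restrict (Icc a b)] 0 := by
  have hint : IntervalIntegrable h volume a b :=
    (intervalIntegrable_iff_integrableOn_Icc_of_le hab).2 hi
  rw [← Measure.restrict_congr_set Ioo_ae_eq_Icc, EventuallyEq, ae_restrict_iff' measurableSet_Ioo]
  filter_upwards [hint.ae_hasDerivAt_integral] with x hx hmem
  have hderiv := hx (Icc_subset_uIcc (Ioo_subset_Icc_self hmem)) a left_mem_uIcc
  have hconst : (fun y => ∫ t in a..y, h t) =ᶠ[𝓝 x] fun _ => 0 := by
    filter_upwards [Ioo_mem_nhds hmem.1 hmem.2] with y hy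
    rw [intervalIntegral.integral_of_le hy.1.le, ← integral_Icc_eq_integral_Ioc]
    exact h0 y (Ioo_subset_Icc_self hy)
  exact hderiv.unique ((hasDerivAt_const x (0 : ℝ)).congr_of_eventuallyEq hconst)

theorem IsWeakDeriv.ae_eq {f g₁ g₂ : ℝ → ℝ} (h₁ : IsWeakDeriv f g₁) (h₂ : IsWeakDeriv f g₂) :
    g₁ =ᵐ[unitVolume] g₂ := by
  have hi₁ : IntegrableOn g₁ (Icc 0 1) := h₁.1.integrable one_le_two
  have hi₂ : IntegrableOn g₂ (Icc 0 1) := h₂.1.integrable one_le_two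
  refine sub_ae_eq_zero _ _ |>.1 <|
    ae_eq_zero_of_setIntegral_Icc_eq_zero zero_le_one (hi₁.sub hi₂) fun x hx => ?_
  have hsub : Icc 0 x ⊆ Icc (0 : ℝ) 1 := Icc_subset_Icc le_rfl hx.2
  simp only [Pi.sub_apply]
  rw [integral_sub (hi₁.mono_set hsub) (hi₂.mono_set hsub)]
  linarith [h₁.2 x hx, h₂.2 x hx]

theorem isWeakDeriv_primitive {g : L2Unit} (hg : ⟪stepFun 1, g⟫_ℝ = 0) :
    IsWeakDeriv (primitive g) g := by
  refine ⟨Lp.memLp g, fun x hx => ?_⟩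
  rw [primitive_of_mem hg hx, primitive_eq_zero g (x := 0) (by simp), integral_Icc_eq_integral_Ioc,
    zero_add]

theorem memH10_primitive {g : L2Unit} (hg : ⟪stepFun 1, g⟫_ℝ = 0) : MemH10 (primitive g) :=
  ⟨⟨g, isWeakDeriv_primitive hg⟩, primitive_eq_zero g fun h => h.1.false,
    primitive_eq_zero g fun h => h.2.false,
    fun _ hx => primitive_eq_zero g fun h => hx (Ioo_subset_Icc_self h)⟩

theorem MemH10.exists_primitive_eq {f : ℝ → ℝ} (hf : MemH10 f) :
    ∃ g : L2Unit, ⟪stepFun 1, g⟫_ℝ = 0 ∧ primitive g = f := by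
  obtain ⟨⟨g, hg, hint⟩, h0, h1, hout⟩ := hf
  have hgf : ∀ x ∈ Icc (0 : ℝ) 1, ∫ t in Ioc 0 x, hg.toLp g t = f x := fun x hx => by
    rw [hint x hx, h0, zero_add, integral_Icc_eq_integral_Ioc]
    exact integral_congr_ae (ae_restrict_of_ae_restrict_of_subset
      (Ioc_subset_Icc_self.trans (Icc_subset_Icc le_rfl hx.2)) hg.coeFn_toLp)
  have hmean : ⟪stepFun 1, hg.toLp g⟫_ℝ = 0 := by
    rw [inner_stepFun le_rfl, hgf 1 (right_mem_Icc.2 zero_le_one), h1]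
  refine ⟨hg.toLp g, hmean, funext fun x => ?_⟩
  by_cases hx : x ∈ Icc (0 : ℝ) 1
  · rw [primitive_of_mem hmean hx, hgf x hx]
  · rw [primitive_eq_zero _ fun h => hx (Ioo_subset_Icc_self h), hout x hx]

theorem eq_zero_of_primitive_eq_zero {g : L2Unit} (hg : ⟪stepFun 1, g⟫_ℝ = 0)
    (h : primitive g = 0) : g = 0 := by
  refine Lp.eq_zero_iff_ae_eq_zero.2 (ae_eq_zero_of_setIntegral_Icc_eq_zero zero_le_one
    ((Lp.memLp g).integrable one_le_two) fun x hx => ?_)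
  rw [integral_Icc_eq_integral_Ioc, ← primitive_of_mem hg hx, h, Pi.zero_apply]

theorem weakDeriv_primitive {g : L2Unit} (hg : ⟪stepFun 1, g⟫_ℝ = 0) :
    weakDeriv (primitive g) =ᵐ[unitVolume] g := by
  have h : ∃ d, IsWeakDeriv (primitive g) d := ⟨g, isWeakDeriv_primitive hg⟩
  rw [weakDeriv, dif_pos h]
  exact h.choose_spec.ae_eq (isWeakDeriv_primitive hg)

theorem energy_primitive {g h : L2Unit} (hg : ⟪stepFun 1, g⟫_ℝ = 0) (hh : ⟪stepFun 1, h⟫_ℝ = 0) :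
    energy (primitive g) (primitive h) = ⟪h, g⟫_ℝ := by
  rw [energy, ← integral_Icc_eq_integral_Ioo, L2.inner_def]
  refine integral_congr_ae ?_
  filter_upwards [weakDeriv_primitive hg, weakDeriv_primitive hh] with x hgx hhx
  rw [hgx, hhx]
  rfl

theorem MemCnu.sub {ν : Measure ℝ} {f g : ℝ → ℝ} (hf : MemCnu ν f) (hg : MemCnu ν g) :
    MemCnu ν (f - g) := by
  refine ⟨hf.1.sub hg.1, fun y hy => ?_⟩
  obtain ⟨p, q, hfC⟩ := hf.2 y hy
  obtain ⟨p', q', hgC⟩ := hg.2 y hy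
  refine ⟨p - p', q - q', fun z hz => ?_⟩
  rw [Pi.sub_apply, hfC z hz, hgC z hz]
  ring

theorem MemCnu.smul {ν : Measure ℝ} {f : ℝ → ℝ} (hf : MemCnu ν f) (c : ℝ) :
    MemCnu ν (c • f) := by
  refine ⟨hf.1.const_smul c, fun y hy => ?_⟩
  obtain ⟨p, q, hfC⟩ := hf.2 y hy
  refine ⟨c * p, c * q, fun z hz => ?_⟩
  rw [Pi.smul_apply, hfC z hz, smul_eq_mul]
  ring

variable {ν : Measure ℝ} [IsFiniteMeasure ν]

theorem primitive_greenOp (g : L2Unit) {z : ℝ} (hz : z ∈ Icc (0 : ℝ) 1) :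
    primitive (greenOp ν g) z = ∫ x, primitive g x * (min x z - x * z) ∂ν := by
  rw [primitive_apply, inner_greenOp]
  congr 1 with x
  by_cases hx : x ∈ Ioo (0 : ℝ) 1
  · rw [primitive_apply (bridge z), inner_bridge_bridge (Ioo_subset_Icc_self hx) hz]
  · rw [primitive_eq_zero g hx, zero_mul, zero_mul]

theorem integrable_primitive_mul_id (g : L2Unit) : Integrable (fun x => primitive g x * x) ν := by
  refine ((memLp_primitive ν g).integrable one_le_two).mono
    ((continuous_primitive g).mul continuous_id).aestronglyMeasurable (ae_of_all _ fun x => ?_)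
  by_cases hx : x ∈ Ioo (0 : ℝ) 1
  · rw [norm_mul]
    exact mul_le_of_le_one_right (norm_nonneg _) ((abs_of_pos hx.1).trans_le hx.2.le)
  · rw [primitive_eq_zero g hx, zero_mul]

theorem lt_iff_lt_of_ordConnected {α : Type*} [LinearOrder α] {C : Set α} (hC : C.OrdConnected)
    {x y z : α} (hx : x ∉ C) (hy : y ∈ C) (hz : z ∈ C) : x < y ↔ x < z :=
  ⟨fun h => not_le.1 fun hzx => hx (hC.out hz hy ⟨hzx, h.le⟩),
    fun h => not_le.1 fun hyx => hx (hC.out hy hz ⟨hyx, h.le⟩)⟩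

theorem memCnu_primitive_greenOp (g : L2Unit) : MemCnu ν (primitive (greenOp ν g)) := by
  refine ⟨(continuous_primitive _).continuousOn, fun y hy => ?_⟩
  set C := connectedComponentIn (Icc (0 : ℝ) 1 \ ν.support) y
  have hC : C.OrdConnected := isPreconnected_connectedComponentIn.ordConnected
  have hCsub : C ⊆ Icc (0 : ℝ) 1 \ ν.support := connectedComponentIn_subset _ _
  -- For `x ∉ C` the Green function `z ↦ min x z - x * z` is affine on `C`, with coefficients
  -- that depend only on the side of `y` on which `x` lies.
  let p : ℝ → ℝ := fun x => (Iio y)ᶜ.indicator (primitive g) x - primitive g x * x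
  let q : ℝ → ℝ := (Iio y).indicator fun x => primitive g x * x
  have hp : Integrable p ν :=
    (((memLp_primitive ν g).integrable one_le_two).indicator measurableSet_Iio.compl).sub
      (integrable_primitive_mul_id g)
  have hq : Integrable q ν := (integrable_primitive_mul_id g).indicator measurableSet_Iio
  refine ⟨∫ x, p x ∂ν, ∫ x, q x ∂ν, fun z hz => ?_⟩
  rw [primitive_greenOp g (hCsub hz).1, ← integral_mul_const, ← integral_add (hp.mul_const z) hq]
  refine integral_congr_ae ?_
  filter_upwards [Measure.support_mem_ae (μ := ν)] with x hx
  have hxC : x ∉ C := fun h => (hCsub h).2 hx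
  have hlt : x < y ↔ x < z := lt_iff_lt_of_ordConnected hC hxC (mem_connectedComponentIn hy) hz
  by_cases hxy : x < y
  · simp only [p, q, indicator, mem_compl_iff, mem_Iio, hxy, min_eq_left (hlt.1 hxy).le,
      not_true_eq_false, if_true, if_false]
    ring
  · simp only [p, q, indicator, mem_compl_iff, mem_Iio, hxy,
      min_eq_right (not_lt.1 (hlt.not.1 hxy)), not_false_eq_true, if_true, if_false]
    ring

theorem isEigenfunction_primitive {g : L2Unit} (hg : ⟪stepFun 1, g⟫_ℝ = 0) (hg0 : g ≠ 0) {l : ℝ}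
    (hl : l ≠ 0) (hT : greenOp ν g = l⁻¹ • g) : IsEigenfunction ν l (primitive g) := by
  have hgT : g = l • greenOp ν g := by rw [hT, smul_inv_smul₀ hl]
  refine ⟨⟨memH10_primitive hg, ?_⟩, fun h => hg0 (eq_zero_of_primitive_eq_zero hg h), ?_⟩
  · rw [hgT, map_smul]
    exact (memCnu_primitive_greenOp g).smul l
  · intro f hf
    obtain ⟨h, hh, rfl⟩ := hf.1.exists_primitive_eq
    rw [energy_primitive hg hh, ← inner_greenOp, hT, real_inner_smul_right,
      mul_inv_cancel_left₀ hl]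

theorem IsEigenfunction.inner_eq {g : L2Unit} (hg : ⟪stepFun 1, g⟫_ℝ = 0) {l : ℝ}
    (hf : IsEigenfunction ν l (primitive g)) {h : L2Unit} (hh : ⟪stepFun 1, h⟫_ℝ = 0)
    (hC : MemCnu ν (primitive h)) : ⟪h, g⟫_ℝ = l * ⟪h, greenOp ν g⟫_ℝ := by
  rw [← energy_primitive hg hh, inner_greenOp]
  exact hf.2.2 _ ⟨memH10_primitive hh, hC⟩

theorem IsEigenfunction.pos {g : L2Unit} (hg : ⟪stepFun 1, g⟫_ℝ = 0) {l : ℝ}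
    (hf : IsEigenfunction ν l (primitive g)) : 0 < l := by
  have hg0 : g ≠ 0 := fun h => hf.2.1 (by rw [h, map_zero])
  have hpos : 0 < l * ⟪g, greenOp ν g⟫_ℝ :=
    (real_inner_self_pos.2 hg0).trans_eq (hf.inner_eq hg hg hf.1.2)
  exact pos_of_mul_pos_left hpos ((isPositive_greenOp ν).inner_nonneg_right g)

theorem IsEigenfunction.greenOp_eq {g : L2Unit} (hg : ⟪stepFun 1, g⟫_ℝ = 0) {l : ℝ}
    (hf : IsEigenfunction ν l (primitive g)) : greenOp ν g = l⁻¹ • g := by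
  set h := g - l • greenOp ν g with hdef
  have hh : ⟪stepFun 1, h⟫_ℝ = 0 := by
    rw [hdef, inner_sub_right, real_inner_smul_right, hg, inner_stepFun_one_greenOp, mul_zero,
      sub_zero]
  have hC : MemCnu ν (primitive h) := by
    rw [hdef, map_sub, map_smul]
    exact hf.1.2.sub ((memCnu_primitive_greenOp g).smul l)
  have hself : ⟪h, h⟫_ℝ = 0 := by
    conv_lhs => rw [hdef]
    rw [← hdef, inner_sub_right, real_inner_smul_right, hf.inner_eq hg hh hC, sub_self]
  rw [eq_inv_smul_iff₀ (hf.pos hg).ne', eq_comm]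
  exact sub_eq_zero.1 (inner_self_eq_zero.1 hself)

theorem inner_stepFun_one_of_mem_upperEigenspace {s : ℝ} (hs : 0 < s) {g : L2Unit}
    (hg : g ∈ upperEigenspace (greenOp ν) s) : ⟪stepFun 1, g⟫_ℝ = 0 := by
  refine Submodule.mem_orthogonal_singleton_iff_inner_right.1
    ((iSup_le fun μ h hh => ?_ : upperEigenspace (greenOp ν) s ≤ (ℝ ∙ stepFun 1)ᗮ) hg)
  have hT : greenOp ν h = (μ : ℝ) • h := Module.End.mem_eigenspace_iff.1 hh
  have h0 := inner_stepFun_one_greenOp ν h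
  rw [hT, real_inner_smul_right] at h0
  exact Submodule.mem_orthogonal_singleton_iff_inner_right.2
    ((mul_eq_zero.1 h0).resolve_left (hs.trans_le μ.2).ne')

theorem span_eigenfunctions_eq_map {x : ℝ} (hx : 0 < x) :
    Submodule.span ℝ {f : ℝ → ℝ | ∃ l ≤ x, IsEigenfunction ν l f} =
      (upperEigenspace (greenOp ν) x⁻¹).map primitive := by
  apply le_antisymm
  · refine Submodule.span_le.2 ?_
    rintro f ⟨l, hl, hf⟩
    obtain ⟨g, hg, rfl⟩ := hf.1.1.exists_primitive_eq
    exact ⟨g, Submodule.mem_iSup_of_mem ⟨l⁻¹, inv_anti₀ (hf.pos hg) hl⟩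
      (Module.End.mem_eigenspace_iff.2 (hf.greenOp_eq hg)), rfl⟩
  · rw [upperEigenspace, Submodule.map_iSup]
    refine iSup_le fun μ => ?_
    rintro f ⟨g, hgμ, rfl⟩
    rcases eq_or_ne g 0 with rfl | hg0
    · rw [map_zero]
      exact Submodule.zero_mem _
    have hμ : (0 : ℝ) < μ := (inv_pos.2 hx).trans_le μ.2
    refine Submodule.subset_span ⟨(μ : ℝ)⁻¹, inv_le_of_inv_le₀ hx μ.2,
      isEigenfunction_primitive (inner_stepFun_one_of_mem_upperEigenspace (inv_pos.2 hx)
        (Submodule.mem_iSup_of_mem μ hgμ)) hg0 (inv_ne_zero hμ.ne') ?_⟩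
    rw [inv_inv]
    exact Module.End.mem_eigenspace_iff.1 hgμ

theorem eigenvalueCount_eq_spectralCount {x : ℝ} (hx : 0 < x) :
    eigenvalueCount ν x = spectralCount (greenOp ν) x⁻¹ := by
  have hinj : Function.Injective (primitive.domRestrict (upperEigenspace (greenOp ν) x⁻¹)) :=
    (injective_iff_map_eq_zero _).2 fun g hg => Subtype.ext <| eq_zero_of_primitive_eq_zero
      (inner_stepFun_one_of_mem_upperEigenspace (inv_pos.2 hx) g.2) hg
  rw [eigenvalueCount, spectralCount, span_eigenfunctions_eq_map hx, ← LinearMap.range_domRestrict,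
    (LinearEquiv.ofInjective _ hinj).rank_eq]

theorem eigenvalueCount_mono {μ : Measure ℝ} (hle : μ ≤ ν) {x : ℝ} (hx : 0 < x) :
    eigenvalueCount μ x ≤ eigenvalueCount ν x := by
  have : IsFiniteMeasure μ := isFiniteMeasure_of_le ν hle
  rw [eigenvalueCount_eq_spectralCount hx, eigenvalueCount_eq_spectralCount hx]
  exact spectralCount_mono (isPositive_greenOp μ).isSymmetric (isCompactOperator_greenOp ν)
    (isPositive_greenOp ν) (frameOp_mono (memLp_bridge ν) hle) (inv_pos.2 hx)

theorem eigenvalueCount_add_le {μ : Measure ℝ} [IsFiniteMeasure μ] {x : ℝ} (hx : 0 < x) :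
    eigenvalueCount (μ + ν) x ≤ eigenvalueCount μ (2 * x) + eigenvalueCount ν (2 * x) := by
  have hx2 : 0 < 2 * x := by positivity
  have hadd : greenOp (μ + ν) = greenOp μ + greenOp ν :=
    frameOp_add_measure (memLp_bridge μ) (memLp_bridge ν)
  rw [eigenvalueCount_eq_spectralCount hx2, eigenvalueCount_eq_spectralCount hx2,
    eigenvalueCount_eq_spectralCount hx, hadd,
    show x⁻¹ = (2 * x)⁻¹ + (2 * x)⁻¹ by field_simp; norm_num]
  exact spectralCount_add_le (isCompactOperator_greenOp μ) (isCompactOperator_greenOp ν)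
    (isPositive_greenOp μ) (isPositive_greenOp ν) (inv_pos.2 hx2) (inv_pos.2 hx2)

end Correspondence

section TestFunctions

/-- The numbers `a < a + w ≤ b - w < b` are the break points of a trapezoidal function on
`[0, 1]`. -/
structure IsTrapezoid (a b w : ℝ) : Prop where
  nonneg : 0 ≤ a
  le_one : b ≤ 1
  width_pos : 0 < w
  add_le_sub : a + w ≤ b - w

/-- The derivative of the trapezoidal function which vanishes outside `(a, b)`, has slope `±1` on
`(a, a + w)` and `(b - w, b)`, and is constant in between. -/
noncomputable def trapezoidDeriv (a b w : ℝ) : L2Unit :=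
  stepFun (a + w) - stepFun a - (stepFun b - stepFun (b - w))

namespace IsTrapezoid

variable {a b w a' b' w' : ℝ}

theorem inner_stepFun (h : IsTrapezoid a b w) {x : ℝ} (hx : x ∈ Icc (0 : ℝ) 1) :
    ⟪stepFun x, trapezoidDeriv a b w⟫_ℝ = max 0 (min w (min (x - a) (b - x))) := by
  obtain ⟨ha, hb, hw, hab⟩ := h
  rw [trapezoidDeriv, inner_sub_right, inner_sub_right, inner_sub_right,
    inner_stepFun_stepFun hx ⟨by linarith, by linarith⟩,
    inner_stepFun_stepFun hx ⟨by linarith, by linarith⟩,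
    inner_stepFun_stepFun hx ⟨by linarith, by linarith⟩,
    inner_stepFun_stepFun hx ⟨by linarith, by linarith⟩]
  grind

theorem primitive_eq (h : IsTrapezoid a b w) (x : ℝ) :
    primitive (trapezoidDeriv a b w) x = max 0 (min w (min (x - a) (b - x))) := by
  have h1 : ⟪stepFun 1, trapezoidDeriv a b w⟫_ℝ = 0 := by
    rw [h.inner_stepFun (right_mem_Icc.2 zero_le_one)]
    have := h.le_one
    grind
  by_cases hx : x ∈ Ioo (0 : ℝ) 1
  · rw [primitive_apply, bridge_of_mem (Ioo_subset_Icc_self hx), inner_sub_left,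
      real_inner_smul_left, h1, mul_zero, sub_zero, h.inner_stepFun (Ioo_subset_Icc_self hx)]
  · rw [primitive_eq_zero _ hx]
    obtain ⟨ha, hb, hw, hab⟩ := h
    grind

theorem norm_sq (h : IsTrapezoid a b w) : ‖trapezoidDeriv a b w‖ ^ 2 = 2 * w := by
  have hT {x : ℝ} (hx : x ∈ Icc a b) : ⟪stepFun x, trapezoidDeriv a b w⟫_ℝ =
      max 0 (min w (min (x - a) (b - x))) :=
    h.inner_stepFun (Icc_subset_Icc h.nonneg h.le_one hx)
  obtain ⟨_, _, hw, hab⟩ := h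
  rw [← real_inner_self_eq_norm_sq]
  nth_rw 1 [trapezoidDeriv]
  rw [inner_sub_left, inner_sub_left, inner_sub_left, hT ⟨by linarith, by linarith⟩,
    hT ⟨by linarith, by linarith⟩, hT ⟨by linarith, by linarith⟩, hT ⟨by linarith, by linarith⟩]
  grind

theorem inner_eq_zero (h : IsTrapezoid a b w) (h' : IsTrapezoid a' b' w')
    (hsep : b ≤ a' ∨ b' ≤ a) : ⟪trapezoidDeriv a b w, trapezoidDeriv a' b' w'⟫_ℝ = 0 := by
  have hzero {x : ℝ} (hx : x ∈ Icc a b) : ⟪stepFun x, trapezoidDeriv a' b' w'⟫_ℝ = 0 := by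
    rw [h'.inner_stepFun (Icc_subset_Icc h.nonneg h.le_one hx)]
    obtain ⟨hxa, hxb⟩ := hx
    grind
  obtain ⟨_, _, hw, hab⟩ := h
  nth_rw 1 [trapezoidDeriv]
  rw [inner_sub_left, inner_sub_left, inner_sub_left, hzero ⟨by linarith, by linarith⟩,
    hzero ⟨by linarith, by linarith⟩, hzero ⟨by linarith, by linarith⟩,
    hzero ⟨by linarith, by linarith⟩]
  norm_num

variable (ν : Measure ℝ) [IsFiniteMeasure ν]

theorem inner_greenOp_eq_zero (h : IsTrapezoid a b w) (h' : IsTrapezoid a' b' w')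
    (hsep : b ≤ a' ∨ b' ≤ a) :
    ⟪greenOp ν (trapezoidDeriv a b w), trapezoidDeriv a' b' w'⟫_ℝ = 0 := by
  rw [real_inner_comm, inner_greenOp]
  refine integral_eq_zero_of_ae (ae_of_all _ fun x => ?_)
  simp only [h.primitive_eq, h'.primitive_eq, Pi.zero_apply, mul_eq_zero]
  grind

theorem le_reApplyInnerSelf_greenOp (h : IsTrapezoid a b w) :
    w ^ 2 * ν.real (Icc (a + w) (b - w)) ≤
      (greenOp ν).reApplyInnerSelf (trapezoidDeriv a b w) := by
  have hint := (memLp_primitive ν (trapezoidDeriv a b w)).integrable_sq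
  rw [reApplyInnerSelf_greenOp, mul_comm, ← smul_eq_mul, ← setIntegral_const]
  refine (setIntegral_mono_on (integrable_const _).integrableOn hint.integrableOn
    measurableSet_Icc fun x hx => ?_).trans
      (setIntegral_le_integral hint (ae_of_all _ fun x => sq_nonneg _))
  have hw : primitive (trapezoidDeriv a b w) x = w := by
    rw [h.primitive_eq]
    have := h.width_pos
    have := hx.1
    have := hx.2
    grind
  rw [hw]

end IsTrapezoid

variable {ν : Measure ℝ} [IsFiniteMeasure ν]

theorem card_le_eigenvalueCount {ι : Type*} [Fintype ι] {a b w : ι → ℝ}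
    (h : ∀ i, IsTrapezoid (a i) (b i) (w i))
    (hsep : Pairwise fun i j => b i ≤ a j ∨ b j ≤ a i) {x : ℝ} (hx : 0 < x)
    (hle : ∀ i, 2 ≤ x * (w i * ν.real (Icc (a i + w i) (b i - w i)))) :
    (Fintype.card ι : ℕ∞) ≤ eigenvalueCount ν x := by
  rw [eigenvalueCount_eq_spectralCount hx]
  refine card_le_spectralCount (v := fun i => trapezoidDeriv (a i) (b i) (w i))
    (isCompactOperator_greenOp ν) (isPositive_greenOp ν) (inv_pos.2 hx)
    (fun i h0 => (h i).width_pos.ne' ?_) (fun i j hij => (h i).inner_eq_zero (h j) (hsep hij))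
    (fun i j hij => (h i).inner_greenOp_eq_zero ν (h j) (hsep hij))
    fun i => le_trans ?_ ((h i).le_reApplyInnerSelf_greenOp ν)
  · simpa [h0] using (h i).norm_sq.symm
  · rw [(h i).norm_sq, inv_mul_le_iff₀ hx]
    nlinarith [mul_le_mul_of_nonneg_left (hle i) (h i).width_pos.le]

theorem packingCount_le_eigenvalueCount {m x : ℝ} (hm : 1 < m) (hx : 0 < x) :
    packingCount ν m x ≤ eigenvalueCount ν x := by
  refine iSup₂_le fun n => ?_
  rintro ⟨a, b, hab, hdisj, hle⟩
  have : 0 < m := zero_lt_one.trans hm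
  have hm1 : 0 < m - 1 := sub_pos.2 hm
  let w : Fin n → ℝ := fun k => (b k - a k) * (m - 1) / (2 * m)
  have hcore (k : Fin n) : Icc (a k + w k) (b k - w k) = core m (a k) (b k) := by
    rw [core]
    congr 1 <;> simp only [w] <;> field_simp <;> ring
  have hw (k : Fin n) : IsTrapezoid (a k) (b k) (w k) := by
    have hlen : 0 < b k - a k := sub_pos.2 (hab k).2.1
    refine ⟨(hab k).1, (hab k).2.2.1, by positivity, ?_⟩
    have : 2 * w k = (b k - a k) - (b k - a k) / m := by simp only [w]; field_simp
    have : 0 < (b k - a k) / m := by positivity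
    linarith
  have hsep : Pairwise fun j k => b j ≤ a k ∨ b k ≤ a j := fun j k hjk => by
    have hdisj := Ioo_disjoint_Ioo.1 (hdisj hjk)
    have := (hab j).2.1
    have := (hab k).2.1
    grind
  rw [← Fintype.card_fin n]
  refine card_le_eigenvalueCount hw hsep hx fun k => ?_
  rw [hcore]
  have h := mul_le_mul_of_nonneg_left (hle k) (by positivity : 0 ≤ x * (m - 1) / 2)
  calc 2 = x * (m - 1) / 2 * (4 / (x * (m - 1))) := by field_simp; norm_num
    _ ≤ _ := h
    _ = _ := by simp only [w]; field_simp

end TestFunctions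

section PartitionBound

theorem norm_sq_eq_integral_sq {α : Type*} [MeasurableSpace α] {μ : Measure α} (g : Lp ℝ 2 μ) :
    ‖g‖ ^ 2 = ∫ x, g x ^ 2 ∂μ := by
  rw [← real_inner_self_eq_norm_sq, L2.inner_def]
  exact integral_congr_ae (ae_of_all _ fun x => by simp)

theorem sq_integral_le {α : Type*} [MeasurableSpace α] {μ : Measure α} [IsFiniteMeasure μ]
    {g : α → ℝ} (hg : MemLp g 2 μ) : (∫ x, g x ∂μ) ^ 2 ≤ μ.real univ * ∫ x, g x ^ 2 ∂μ := by
  have h := real_inner_mul_inner_self_le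
    (indicatorConstLp 2 MeasurableSet.univ (measure_ne_top μ univ) 1) (hg.toLp g)
  rw [L2.inner_indicatorConstLp_one, real_inner_self_eq_norm_sq (hg.toLp g),
    norm_sq_eq_integral_sq, L2.inner_indicatorConstLp_one_indicatorConstLp_one MeasurableSet.univ
      MeasurableSet.univ, Measure.restrict_univ, ← sq, inter_self] at h
  simpa only [RCLike.ofReal_real_eq_id, id_eq, integral_congr_ae hg.coeFn_toLp,
    integral_congr_ae (hg.coeFn_toLp.mono fun _ hx => congrArg (· ^ 2) hx)] using h

theorem setIntegral_Ioc_eq_sum {μ : Measure ℝ} {f : ℝ → ℝ} {n : ℕ} {c : Fin (n + 1) → ℝ}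
    (hc : Monotone c) (hf : IntegrableOn f (Ioc (c 0) (c (Fin.last n))) μ) :
    ∫ x in Ioc (c 0) (c (Fin.last n)), f x ∂μ =
      ∑ k : Fin n, ∫ x in Ioc (c k.castSucc) (c k.succ), f x ∂μ := by
  induction n with
  | zero => simp
  | succ n ih =>
    have h1 : c 0 ≤ c (Fin.last n).castSucc := hc (Fin.zero_le _)
    have h2 : c (Fin.last n).castSucc ≤ c (Fin.last (n + 1)) := hc (Fin.le_last _)
    rw [← Ioc_union_Ioc_eq_Ioc h1 h2] at hf ⊢
    rw [setIntegral_union (Ioc_disjoint_Ioc_of_le le_rfl) measurableSet_Ioc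
      hf.left_of_union hf.right_of_union, Fin.sum_univ_castSucc]
    congr 1
    exact ih (c := c ∘ Fin.castSucc) (hc.comp Fin.strictMono_castSucc.monotone) hf.left_of_union

theorem sq_primitive_le {g : L2Unit} (hg : ⟪stepFun 1, g⟫_ℝ = 0) {u v x : ℝ} (hu : 0 ≤ u)
    (hv : v ≤ 1) (hx : x ∈ Ioc u v) (h0 : primitive g u = 0) :
    primitive g x ^ 2 ≤ (v - u) * ∫ t in Ioc u v, g t ^ 2 := by
  have hsub : Ioc u v ⊆ Icc 0 1 := Ioc_subset_Icc_self.trans (Icc_subset_Icc hu hv)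
  have hxsub : Ioc u x ⊆ Ioc u v := Ioc_subset_Ioc_right hx.2
  have hLp {A : Set ℝ} (hA : A ⊆ Icc 0 1) : MemLp g 2 (volume.restrict A) :=
    (Lp.memLp g).mono_measure (Measure.restrict_mono hA le_rfl)
  have hint {A : Set ℝ} (hA : A ⊆ Icc 0 1) : IntegrableOn g A :=
    ((Lp.memLp g).integrable one_le_two).mono_measure (Measure.restrict_mono hA le_rfl)
  have hprim : primitive g x = ∫ t in Ioc u x, g t := by
    have hux : Ioc 0 u ⊆ Icc 0 1 :=
      Ioc_subset_Icc_self.trans (Icc_subset_Icc le_rfl (hx.1.le.trans (hx.2.trans hv)))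
    rw [primitive_of_mem hg (hsub hx), ← Ioc_union_Ioc_eq_Ioc hu hx.1.le,
      setIntegral_union (Ioc_disjoint_Ioc_of_le le_rfl) measurableSet_Ioc (hint hux)
        (hint (hxsub.trans hsub)), ← primitive_of_mem hg ⟨hu, hx.1.le.trans (hx.2.trans hv)⟩, h0,
      zero_add]
  calc primitive g x ^ 2 ≤ (x - u) * ∫ t in Ioc u x, g t ^ 2 := by
        simpa [hprim, hx.1.le] using sq_integral_le (hLp (hxsub.trans hsub))
    _ ≤ (v - u) * ∫ t in Ioc u v, g t ^ 2 := by
        refine mul_le_mul (by linarith [hx.2]) ?_ (integral_nonneg fun t => sq_nonneg _)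
          (by linarith [hx.1, hx.2])
        exact setIntegral_mono_set (hLp hsub).integrable_sq (ae_of_all _ fun t => sq_nonneg _)
          (ae_of_all _ hxsub)

variable {ν : Measure ℝ} [IsFiniteMeasure ν]

theorem setIntegral_sq_primitive_le {g : L2Unit} (hg : ⟪stepFun 1, g⟫_ℝ = 0) {u v : ℝ}
    (hu : 0 ≤ u) (hv : v ≤ 1) (h0 : primitive g u = 0) :
    ∫ x in Ioc u v, primitive g x ^ 2 ∂ν ≤
      ν.real (Ioc u v) * (v - u) * ∫ t in Ioc u v, g t ^ 2 := by
  rw [mul_assoc, ← smul_eq_mul, ← setIntegral_const]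
  exact setIntegral_mono_on (memLp_primitive ν g).integrable_sq.integrableOn
    (integrable_const _).integrableOn measurableSet_Ioc fun x hx => sq_primitive_le hg hu hv hx h0

theorem reApplyInnerSelf_greenOp_lt {s : ℝ} {n : ℕ} {c : Fin (n + 1) → ℝ} (hc : Monotone c)
    (hc0 : c 0 = 0) (hc1 : c (Fin.last n) = 1)
    (hlt : ∀ k : Fin n, ν.real (Ioc (c k.castSucc) (c k.succ)) * (c k.succ - c k.castSucc) < s)
    {g : L2Unit} (hg : ⟪stepFun 1, g⟫_ℝ = 0) (hg0 : g ≠ 0)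
    (hzero : ∀ k : Fin n, primitive g (c k.castSucc) = 0) :
    (greenOp ν).reApplyInnerSelf g < s * ‖g‖ ^ 2 := by
  have hnorm : ‖g‖ ^ 2 = ∑ k : Fin n, ∫ t in Ioc (c k.castSucc) (c k.succ), g t ^ 2 := by
    rw [← setIntegral_Ioc_eq_sum hc, hc0, hc1, norm_sq_eq_integral_sq,
      integral_Icc_eq_integral_Ioc]
    rw [hc0, hc1]
    exact IntegrableOn.mono_set (Lp.memLp g).integrable_sq Ioc_subset_Icc_self
  have hform : (greenOp ν).reApplyInnerSelf g =
      ∑ k : Fin n, ∫ x in Ioc (c k.castSucc) (c k.succ), primitive g x ^ 2 ∂ν := by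
    rw [← setIntegral_Ioc_eq_sum hc (memLp_primitive ν g).integrable_sq.integrableOn, hc0, hc1,
      reApplyInnerSelf_greenOp, setIntegral_eq_integral_of_forall_compl_eq_zero]
    intro x hx
    rw [primitive_eq_zero g fun h => hx (Ioo_subset_Ioc_self h), sq, mul_zero]
  have hpart (k : Fin n) := setIntegral_sq_primitive_le (ν := ν) hg (u := c k.castSucc)
    (v := c k.succ) (hc0 ▸ hc (Fin.zero_le _)) (hc1 ▸ hc (Fin.le_last _)) (hzero k)
  have hnonneg (k : Fin n) : 0 ≤ ∫ t in Ioc (c k.castSucc) (c k.succ), g t ^ 2 :=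
    integral_nonneg fun t => sq_nonneg _
  obtain ⟨i, hi, hpos⟩ : ∃ i ∈ Finset.univ,
      0 < ∫ t in Ioc (c (Fin.castSucc i)) (c (Fin.succ i)), g t ^ 2 := by
    refine Finset.exists_lt_of_sum_lt ?_
    rw [← hnorm, Finset.sum_const_zero]
    exact pow_pos (norm_pos_iff.2 hg0) 2
  rw [hform, hnorm, Finset.mul_sum]
  exact Finset.sum_lt_sum
    (fun k _ => (hpart k).trans (mul_le_mul_of_nonneg_right (hlt k).le (hnonneg k)))
    ⟨i, hi, (hpart i).trans_lt (mul_lt_mul_of_pos_right (hlt i) hpos)⟩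

theorem eigenvalueCount_le_partitionCount {x : ℝ} (hx : 0 < x) :
    eigenvalueCount ν x ≤ partitionCount ν x := by
  refine le_iInf₂ fun n => ?_
  rintro ⟨c, ⟨hc, hc0, hc1, -⟩, hlt⟩
  rw [eigenvalueCount_eq_spectralCount hx, ← Module.finrank_fin_fun ℝ (n := n)]
  refine spectralCount_le_finrank (isPositive_greenOp ν).isSymmetric
    (LinearMap.funLeft ℝ ℝ (fun k : Fin n => c k.castSucc) ∘ₗ primitive) fun g hg hL hg0 => ?_
  exact reApplyInnerSelf_greenOp_lt hc.monotone hc0 hc1 (one_div x ▸ hlt)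
    (inner_stepFun_one_of_mem_upperEigenspace (inv_pos.2 hx) hg) hg0 fun k => congrFun hL k

end PartitionBound

section Growth

variable {N M : ℝ → ℕ∞} {r : ℝ}

theorem logRatio_le_iff {x : ℝ} (hx : 1 < x) :
    logRatio N x ≤ r ↔ (N x : ℝ≥0∞) ≤ ENNReal.ofReal (x ^ r) := by
  have hx0 : 0 < x := zero_lt_one.trans hx
  rw [logRatio, EReal.div_le_iff_le_mul (by exact_mod_cast Real.log_pos hx) (EReal.coe_ne_top _),
    ← ENNReal.log_le_log_iff, ENNReal.log_ofReal_of_pos (Real.rpow_pos_of_pos hx0 r),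
    Real.log_rpow hx0, mul_comm r, EReal.coe_mul]

theorem le_logRatio_iff {x : ℝ} (hx : 1 < x) :
    r ≤ logRatio N x ↔ ENNReal.ofReal (x ^ r) ≤ (N x : ℝ≥0∞) := by
  have hx0 : 0 < x := zero_lt_one.trans hx
  rw [logRatio, EReal.le_div_iff_mul_le (by exact_mod_cast Real.log_pos hx) (EReal.coe_ne_top _),
    ← ENNReal.log_le_log_iff, ENNReal.log_ofReal_of_pos (Real.rpow_pos_of_pos hx0 r),
    Real.log_rpow hx0, EReal.coe_mul]

theorem eventually_le_rpow_of_limsup_lt (h : limsup (logRatio N) atTop < r) :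
    ∀ᶠ x in atTop, (N x : ℝ≥0∞) ≤ ENNReal.ofReal (x ^ r) := by
  filter_upwards [eventually_lt_of_limsup_lt h, eventually_gt_atTop 1] with x hx h1
  exact (logRatio_le_iff h1).1 hx.le

theorem eventually_rpow_le_of_lt_liminf (h : r < liminf (logRatio N) atTop) :
    ∀ᶠ x in atTop, ENNReal.ofReal (x ^ r) ≤ (N x : ℝ≥0∞) := by
  filter_upwards [eventually_lt_of_lt_liminf h, eventually_gt_atTop 1] with x hx h1
  exact (le_logRatio_iff h1).1 hx.le

theorem eventually_const_mul_rpow_le (C : ℝ) {r r' : ℝ} (h : r < r') :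
    ∀ᶠ x : ℝ in atTop, C * x ^ r ≤ x ^ r' := by
  filter_upwards [(tendsto_rpow_atTop (sub_pos.2 h)).eventually_ge_atTop C,
    eventually_gt_atTop 0] with x hx h0
  calc C * x ^ r ≤ x ^ (r' - r) * x ^ r :=
        mul_le_mul_of_nonneg_right hx (Real.rpow_nonneg h0.le r)
    _ = x ^ r' := by rw [← Real.rpow_add h0, sub_add_cancel]

theorem limsup_logRatio_le (C : ℝ)
    (h : ∀ᶠ x in atTop, (N x : ℝ≥0∞) ≤ ENNReal.ofReal (C * x ^ r)) :
    limsup (logRatio N) atTop ≤ r := by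
  refine EReal.le_of_forall_lt_iff_le.1 fun r' hr' => limsup_le_of_le (by isBoundedDefault) ?_
  filter_upwards [h, eventually_const_mul_rpow_le C (EReal.coe_lt_coe_iff.1 hr'),
    eventually_gt_atTop 1] with x h1 h2 h3
  exact (logRatio_le_iff h3).2 (h1.trans (ENNReal.ofReal_le_ofReal h2))

theorem le_liminf_logRatio {C : ℝ} (hC : 0 < C)
    (h : ∀ᶠ x in atTop, ENNReal.ofReal (C * x ^ r) ≤ (N x : ℝ≥0∞)) :
    r ≤ liminf (logRatio N) atTop := by
  refine EReal.ge_of_forall_gt_iff_ge.1 fun r' hr' => le_liminf_of_le (by isBoundedDefault) ?_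
  filter_upwards [h, eventually_const_mul_rpow_le C⁻¹ (EReal.coe_lt_coe_iff.1 hr'),
    eventually_gt_atTop 1] with x h1 h2 h3
  refine (le_logRatio_iff h3).2 ((ENNReal.ofReal_le_ofReal ?_).trans h1)
  rwa [inv_mul_le_iff₀ hC] at h2

theorem logRatio_mono {x : ℝ} (hx : 1 < x) (h : N x ≤ M x) : logRatio N x ≤ logRatio M x :=
  EReal.div_le_div_right_of_nonneg (by exact_mod_cast (Real.log_pos hx).le)
    (ENNReal.log_monotone (by exact_mod_cast h))

theorem limsup_logRatio_mono (h : ∀ᶠ x in atTop, N x ≤ M x) :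
    limsup (logRatio N) atTop ≤ limsup (logRatio M) atTop := by
  refine limsup_le_limsup ?_ (by isBoundedDefault) (by isBoundedDefault)
  filter_upwards [h, eventually_gt_atTop 1] with x h1 h2
  exact logRatio_mono h2 h1

theorem liminf_logRatio_mono (h : ∀ᶠ x in atTop, N x ≤ M x) :
    liminf (logRatio N) atTop ≤ liminf (logRatio M) atTop := by
  refine liminf_le_liminf ?_ (by isBoundedDefault) (by isBoundedDefault)
  filter_upwards [h, eventually_gt_atTop 1] with x h1 h2
  exact logRatio_mono h2 h1

theorem limsup_logRatio_comp_mul_le {c : ℝ} (hc : 0 < c) :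
    limsup (logRatio fun x => N (c * x)) atTop ≤ limsup (logRatio N) atTop := by
  refine EReal.le_of_forall_lt_iff_le.1 fun r hr => limsup_logRatio_le (c ^ r) ?_
  filter_upwards [(tendsto_id.const_mul_atTop hc).eventually (eventually_le_rpow_of_limsup_lt hr),
    eventually_ge_atTop 0] with x hx hx0
  rwa [← Real.mul_rpow hc.le hx0]

theorem liminf_logRatio_le_comp_mul {c : ℝ} (hc : 0 < c) :
    liminf (logRatio N) atTop ≤ liminf (logRatio fun x => N (c * x)) atTop := by
  refine EReal.ge_of_forall_gt_iff_ge.1 fun r hr =>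
    le_liminf_logRatio (Real.rpow_pos_of_pos hc r) ?_
  filter_upwards [(tendsto_id.const_mul_atTop hc).eventually (eventually_rpow_le_of_lt_liminf hr),
    eventually_ge_atTop 0] with x hx hx0
  rwa [← Real.mul_rpow hc.le hx0]

theorem limsup_logRatio_add_le :
    limsup (logRatio fun x => N x + M x) atTop ≤
      max (limsup (logRatio N) atTop) (limsup (logRatio M) atTop) := by
  refine EReal.le_of_forall_lt_iff_le.1 fun r hr => limsup_logRatio_le 2 ?_
  rw [max_lt_iff] at hr
  filter_upwards [eventually_le_rpow_of_limsup_lt hr.1, eventually_le_rpow_of_limsup_lt hr.2,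
    eventually_ge_atTop 0] with x hN hM hx
  rw [two_mul, ENNReal.ofReal_add (Real.rpow_nonneg hx r) (Real.rpow_nonneg hx r)]
  push_cast
  exact add_le_add hN hM

end Growth

section SpectralDimension

variable {μ ν : Measure ℝ} [IsFiniteMeasure ν]

theorem lowerSpectralDim_mono (hle : μ ≤ ν) : lowerSpectralDim μ ≤ lowerSpectralDim ν :=
  liminf_logRatio_mono <| (eventually_gt_atTop 0).mono fun _ => eigenvalueCount_mono hle

theorem upperSpectralDim_mono (hle : μ ≤ ν) : upperSpectralDim μ ≤ upperSpectralDim ν :=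
  limsup_logRatio_mono <| (eventually_gt_atTop 0).mono fun _ => eigenvalueCount_mono hle

theorem upperSpectralDim_add [IsFiniteMeasure μ] :
    upperSpectralDim (μ + ν) = max (upperSpectralDim μ) (upperSpectralDim ν) := by
  apply le_antisymm
  · calc upperSpectralDim (μ + ν)
        ≤ limsup (logRatio fun x => eigenvalueCount μ (2 * x) + eigenvalueCount ν (2 * x)) atTop :=
          limsup_logRatio_mono <| (eventually_gt_atTop 0).mono fun _ => eigenvalueCount_add_le
      _ ≤ _ := limsup_logRatio_add_le
      _ ≤ _ := max_le_max (limsup_logRatio_comp_mul_le two_pos)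
          (limsup_logRatio_comp_mul_le two_pos)
  · exact max_le (upperSpectralDim_mono (Measure.le_add_right le_rfl))
      (upperSpectralDim_mono (Measure.le_add_left le_rfl))

theorem lowerSpectralDim_le_upperSpectralDim (ν : Measure ℝ) :
    lowerSpectralDim ν ≤ upperSpectralDim ν :=
  liminf_le_limsup (by isBoundedDefault) (by isBoundedDefault)

theorem upperSpectralDim_le_upperEntropy : upperSpectralDim ν ≤ upperEntropy ν :=
  limsup_logRatio_mono <| (eventually_gt_atTop 0).mono fun _ => eigenvalueCount_le_partitionCount

theorem lowerReducedEntropy_le_lowerSpectralDim {m : ℝ} (hm : 1 < m) :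
    lowerReducedEntropy ν m ≤ lowerSpectralDim ν :=
  liminf_logRatio_mono <| (eventually_gt_atTop 0).mono fun _ => packingCount_le_eigenvalueCount hm

theorem one_le_partitionCount (ν : Measure ℝ) (x : ℝ) : 1 ≤ partitionCount ν x := by
  refine le_iInf₂ fun n => ?_
  rintro ⟨c, ⟨-, h0, h1, -⟩, -⟩
  rcases n with _ | n
  · rw [Fin.last_zero, h0] at h1
    exact absurd h1 zero_ne_one
  · exact_mod_cast Nat.succ_le_succ n.zero_le

theorem upperEntropy_nonneg (ν : Measure ℝ) : 0 ≤ upperEntropy ν := by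
  refine le_limsup_of_frequently_le (Eventually.frequently ?_) (by isBoundedDefault)
  filter_upwards [eventually_gt_atTop 1] with x hx
  rw [← EReal.coe_zero, le_logRatio_iff hx, Real.rpow_zero, ENNReal.ofReal_one]
  exact_mod_cast one_le_partitionCount ν x

end SpectralDimension

section ReducedEntropy

variable {μ ν : Measure ℝ} [IsFiniteMeasure ν]

theorem exists_mem_Ioo_forall_measure_singleton_eq_zero (ν : Measure ℝ) [SFinite ν] {ι : Type*}
    [Countable ι] {φ : ι → ℝ → ℝ} (hφ : ∀ i, Function.Injective (φ i)) {a b : ℝ} (hab : a < b) :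
    ∃ ε ∈ Ioo a b, ∀ i, ν {φ i ε} = 0 := by
  have hatoms : {y : ℝ | 0 < ν {y}}.Countable :=
    Measure.countable_meas_pos_of_disjoint_iUnion measurableSet_singleton
      fun _ _ => disjoint_singleton.2
  have hcount : (⋃ i, φ i ⁻¹' {y : ℝ | 0 < ν {y}}).Countable :=
    countable_iUnion fun i => hatoms.preimage (hφ i)
  obtain ⟨ε, hε, hmem⟩ := (hcount.dense_compl ℝ).exists_between hab
  simp only [mem_compl_iff, mem_iUnion, mem_preimage, mem_ofPred_eq, not_exists, not_lt,
    nonpos_iff_eq_zero] at hε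
  exact ⟨ε, hmem, hε⟩

-- The intervals are shrunk by a common proportion `ε` chosen so that the new endpoints avoid the
-- atoms of `ν`; the parameter `m' < m` leaves room for this.
theorem core_subset_core {m m' a b δ : ℝ} (h : (b - a) / m ≤ (b - δ - (a + δ)) / m') :
    core m a b ⊆ core m' (a + δ) (b - δ) := by
  refine Icc_subset_Icc ?_ ?_ <;> rw [mul_comm 2 m, mul_comm 2 m', ← div_div, ← div_div] <;>
    linarith

theorem packingCount_le_packingCount_of_le (hle : μ ≤ ν) {m m' x : ℝ} (hm' : 1 < m')
    (hm : m' < m) : packingCount μ m x ≤ packingCount ν m' ((m - 1) / (m' - 1) * x) := by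
  refine iSup₂_le fun n => ?_
  rintro ⟨a, b, hab, hdisj, hcore⟩
  have : IsFiniteMeasure μ := isFiniteMeasure_of_le ν hle
  have hm'0 : 0 < m' := zero_lt_one.trans hm'
  have hm0 : 0 < m := hm'0.trans hm
  have hlen (k : Fin n) : 0 < b k - a k := sub_pos.2 (hab k).2.1
  obtain ⟨ε, ⟨hε0, hε1⟩, hε⟩ := exists_mem_Ioo_forall_measure_singleton_eq_zero ν
    (φ := Sum.elim (fun k ε => a k + ε * (b k - a k)) fun k ε => b k - ε * (b k - a k))
    (by
      rintro (k | k) s t hst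
      · exact mul_right_cancel₀ (hlen k).ne' (add_left_cancel hst)
      · exact mul_right_cancel₀ (hlen k).ne' (sub_right_injective hst))
    (half_pos (sub_pos.2 ((div_lt_one hm0).2 hm)))
  have hεlen (k : Fin n) : 0 < ε * (b k - a k) := mul_pos hε0 (hlen k)
  have hwidth (k : Fin n) : (b k - a k) / m ≤
      (b k - ε * (b k - a k) - (a k + ε * (b k - a k))) / m' := by
    rw [le_div_iff₀ hm'0]
    calc (b k - a k) / m * m' = m' / m * (b k - a k) := by ring
      _ ≤ (1 - 2 * ε) * (b k - a k) := mul_le_mul_of_nonneg_right (by linarith) (hlen k).le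
      _ = _ := by ring
  have hlt (k : Fin n) : a k + ε * (b k - a k) < b k - ε * (b k - a k) :=
    sub_pos.1 ((div_pos_iff_of_pos_right hm'0).1 ((div_pos (hlen k) hm0).trans_le (hwidth k)))
  refine le_iSup₂_of_le n ⟨fun k => a k + ε * (b k - a k), fun k => b k - ε * (b k - a k),
    fun k => ⟨by linarith [(hab k).1, hεlen k], hlt k, by linarith [(hab k).2.2.1, hεlen k],
      hε (Sum.inl k), hε (Sum.inr k)⟩, fun j k hjk => ?_, fun k => ?_⟩ le_rfl
  · exact (hdisj hjk).mono
      (Ioo_subset_Ioo (by linarith [hεlen j]) (by linarith [hεlen j]))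
      (Ioo_subset_Ioo (by linarith [hεlen k]) (by linarith [hεlen k]))
  · have hscale : (m - 1) / (m' - 1) * x * (m' - 1) = x * (m - 1) := by
      field_simp [sub_ne_zero.2 hm'.ne']
    rw [hscale]
    exact (hcore k).trans (mul_le_mul ((measureReal_mono (core_subset_core (hwidth k))).trans
      (ENNReal.toReal_mono (measure_ne_top _ _) (hle _))) (hwidth k)
        (div_pos (hlen k) hm0).le measureReal_nonneg)

theorem lowerReducedEntropy_le_of_le (hle : μ ≤ ν) {m m' : ℝ} (hm' : 1 < m') (hm : m' < m) :
    lowerReducedEntropy μ m ≤ lowerReducedEntropy ν m' := by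
  have hc : 0 < (m - 1) / (m' - 1) := div_pos (by linarith) (by linarith)
  calc lowerReducedEntropy μ m
      ≤ liminf (logRatio fun x => packingCount μ m (((m - 1) / (m' - 1))⁻¹ * x)) atTop :=
        liminf_logRatio_le_comp_mul (inv_pos.2 hc)
    _ ≤ lowerReducedEntropy ν m' := liminf_logRatio_mono <| Eventually.of_forall fun x => by
        simpa only [mul_inv_cancel_left₀ hc.ne'] using packingCount_le_packingCount_of_le hle
          (x := ((m - 1) / (m' - 1))⁻¹ * x) hm' hm

theorem iSup_lowerReducedEntropy_mono (hle : μ ≤ ν) :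
    (⨆ (m : ℝ) (_ : 1 < m), lowerReducedEntropy μ m) ≤
      ⨆ (m : ℝ) (_ : 1 < m), lowerReducedEntropy ν m := by
  refine iSup₂_le fun m hm => ?_
  obtain ⟨m', hm', hm'm⟩ := exists_between hm
  exact le_iSup₂_of_le m' hm' (lowerReducedEntropy_le_of_le hle hm' hm'm)

end ReducedEntropy

section HeavyIntervals

/-- The `k`-th dyadic interval of order `n`. -/
def dyadicIoc (n k : ℕ) : Set ℝ := Ioc ((k : ℝ) / 2 ^ n) (((k : ℝ) + 1) / 2 ^ n)

open Classical in
/-- The indices of the dyadic subintervals of `(0, 1]` of order `n` whose measure is at least the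
threshold `t`; the thresholds `2 ^ (-α * n)` give the intervals counted by `dyadicCount`. -/
noncomputable def heavy (ν : Measure ℝ) (t : ℝ) (n : ℕ) : Finset ℕ :=
  {k ∈ Finset.range (2 ^ n) | t ≤ ν.real (dyadicIoc n k)}

variable {μ ν : Measure ℝ} {s t α : ℝ} {n k : ℕ}

theorem mem_heavy : k ∈ heavy ν t n ↔ k < 2 ^ n ∧ t ≤ ν.real (dyadicIoc n k) := by
  rw [heavy, Finset.mem_filter, Finset.mem_range]

theorem card_heavy_le_two_pow (ν : Measure ℝ) (t : ℝ) (n : ℕ) : (heavy ν t n).card ≤ 2 ^ n :=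
  (Finset.card_filter_le _ _).trans_eq (Finset.card_range _)

theorem heavy_anti (ν : Measure ℝ) (h : s ≤ t) (n : ℕ) : heavy ν t n ⊆ heavy ν s n := fun _ hk =>
  mem_heavy.2 ⟨(mem_heavy.1 hk).1, h.trans (mem_heavy.1 hk).2⟩

theorem heavy_mono [IsFiniteMeasure ν] (hle : μ ≤ ν) (t : ℝ) (n : ℕ) :
    heavy μ t n ⊆ heavy ν t n := fun _ hk =>
  mem_heavy.2 ⟨(mem_heavy.1 hk).1,
    (mem_heavy.1 hk).2.trans (ENNReal.toReal_mono (measure_ne_top _ _) (hle _))⟩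

theorem dyadicCount_eq_card_heavy (ν : Measure ℝ) (α : ℝ) (n : ℕ) :
    dyadicCount ν α n = (heavy ν (2 ^ (-α * n)) n).card := by
  rw [dyadicCount, ← ncard_coe_finset]
  congr 1
  ext k
  exact mem_heavy.symm

theorem dyadicCount_mono [IsFiniteMeasure ν] (hle : μ ≤ ν) (α : ℝ) (n : ℕ) :
    dyadicCount μ α n ≤ dyadicCount ν α n := by
  simpa only [dyadicCount_eq_card_heavy] using Finset.card_le_card (heavy_mono hle _ n)

variable [IsFiniteMeasure ν]

-- The trapezoids over the tripled dyadic intervals have disjoint supports, because two distinct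
-- indices in the same residue class modulo `3` differ by at least `3`.
theorem card_le_eigenvalueCount_of_subset_heavy (ht : 0 < t) {F : Finset ℕ}
    (hF : F ⊆ heavy ν t n) (hpos : ∀ k ∈ F, 1 ≤ k) (hlt : ∀ k ∈ F, k + 2 ≤ 2 ^ n)
    (hmod : ∀ j ∈ F, ∀ k ∈ F, j % 3 = k % 3) :
    (F.card : ℕ∞) ≤ eigenvalueCount ν (2 * 2 ^ n / t) := by
  have hn : (0 : ℝ) < 2 ^ n := by positivity
  rw [← Fintype.card_coe F]
  refine card_le_eigenvalueCount (a := fun k : F => ((k : ℝ) - 1) / 2 ^ n)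
    (b := fun k : F => ((k : ℝ) + 2) / 2 ^ n) (w := fun _ => 1 / 2 ^ n) (fun k => ?_)
    (fun j k hjk => ?_) (by positivity) fun k => ?_
  · have h1 : (1 : ℝ) ≤ (k : ℕ) := by exact_mod_cast hpos k k.2
    have h2 : ((k : ℕ) : ℝ) + 2 ≤ 2 ^ n := by exact_mod_cast hlt k k.2
    refine ⟨div_nonneg (by linarith) hn.le, (div_le_one hn).2 h2, by positivity, ?_⟩
    rw [← add_div, ← sub_div]
    exact div_le_div_of_nonneg_right (by linarith) hn.le
  · have hne : (j : ℕ) ≠ k := Subtype.coe_ne_coe.2 hjk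
    have := hmod j j.2 k k.2
    have h3 : (j : ℕ) + 3 ≤ k ∨ (k : ℕ) + 3 ≤ j := by omega
    refine h3.imp (fun h => ?_) fun h => ?_
    all_goals
      rify at h
      exact div_le_div_of_nonneg_right (by linarith) hn.le
  · have hcore : t ≤ ν.real
        (Icc (((k : ℝ) - 1) / 2 ^ n + 1 / 2 ^ n) (((k : ℝ) + 2) / 2 ^ n - 1 / 2 ^ n)) := by
      refine (mem_heavy.1 (hF k.2)).2.trans (measureReal_mono fun x hx => ?_)
      rw [← add_div, ← sub_div]
      convert Ioc_subset_Icc_self hx using 3 <;> ring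
    calc (2 : ℝ) = 2 * 2 ^ n / t * (1 / 2 ^ n * t) := by field_simp
      _ ≤ _ := by gcongr

theorem card_heavy_le_eigenvalueCount (ht : 0 < t) (n : ℕ) :
    ((heavy ν t n).card : ℕ∞) ≤ 2 + 3 * eigenvalueCount ν (2 * 2 ^ n / t) := by
  let F := {k ∈ heavy ν t n | 1 ≤ k ∧ k + 2 ≤ 2 ^ n}
  have hcover : heavy ν t n ⊆ {0, 2 ^ n - 1} ∪ F := fun k hk => by
    have := (mem_heavy.1 hk).1
    simp only [F, Finset.mem_union, Finset.mem_insert, Finset.mem_singleton, Finset.mem_filter, hk,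
      true_and]
    omega
  have hresidue (i : ℕ) :
      (({k ∈ F | k % 3 = i}.card : ℕ) : ℕ∞) ≤ eigenvalueCount ν (2 * 2 ^ n / t) := by
    refine card_le_eigenvalueCount_of_subset_heavy ht
      ((Finset.filter_subset _ _).trans (Finset.filter_subset _ _)) (fun k hk => ?_)
      (fun k hk => ?_) fun j hj k hk => ?_ <;> simp only [F, Finset.mem_filter] at *
    exacts [hk.1.2.1, hk.1.2.2, hj.2.trans hk.2.symm]
  have hF : (F.card : ℕ∞) ≤ 3 * eigenvalueCount ν (2 * 2 ^ n / t) := by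
    rw [Finset.card_eq_sum_card_fiberwise (f := (· % 3)) (t := Finset.range 3)
      fun k _ => Finset.mem_coe.2 (Finset.mem_range.2 (Nat.mod_lt k three_pos)), Nat.cast_sum]
    simpa using Finset.sum_le_card_nsmul (Finset.range 3) _ _ fun i _ => hresidue i
  calc ((heavy ν t n).card : ℕ∞) ≤ (2 + F.card : ℕ) :=
        Nat.cast_le.2 <| (Finset.card_le_card hcover).trans <| (Finset.card_union_le _ _).trans <|
          Nat.add_le_add_right Finset.card_le_two _
    _ ≤ 2 + 3 * eigenvalueCount ν (2 * 2 ^ n / t) := by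
        rw [Nat.cast_add, Nat.cast_ofNat]
        exact add_le_add_right hF 2

theorem dyadicCount_le_eigenvalueCount (ν : Measure ℝ) [IsFiniteMeasure ν] (α : ℝ) (n : ℕ) :
    (dyadicCount ν α n : ℕ∞) ≤ 2 + 3 * eigenvalueCount ν (2 * 2 ^ ((1 + α) * n)) := by
  have hx : 2 * (2 : ℝ) ^ ((1 + α) * n) = 2 * 2 ^ n / 2 ^ (-α * n) := by
    rw [mul_div_assoc, ← Real.rpow_natCast, ← Real.rpow_sub two_pos]
    ring_nf
  rw [dyadicCount_eq_card_heavy, hx]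
  exact card_heavy_le_eigenvalueCount (by positivity) n

end HeavyIntervals

section MFDim

variable {μ ν : Measure ℝ} {α ρ K : ℝ}

theorem dyadicRatio_eq (ν : Measure ℝ) (α : ℝ) (n : ℕ) :
    dyadicRatio ν α n = ((Real.log (dyadicCount ν α n) / (n * Real.log 2) : ℝ) : EReal) := by
  rw [dyadicRatio, Real.log_of_nat_eq_posLog, Real.log_pow]

theorem dyadicRatio_nonneg (ν : Measure ℝ) (α : ℝ) (n : ℕ) : 0 ≤ dyadicRatio ν α n := by
  rw [dyadicRatio_eq, EReal.coe_nonneg]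
  exact div_nonneg (Real.log_natCast_nonneg _)
    (mul_nonneg n.cast_nonneg (Real.log_pos one_lt_two).le)

theorem dyadicRatio_mono [IsFiniteMeasure ν] (hle : μ ≤ ν) (α : ℝ) (n : ℕ) :
    dyadicRatio μ α n ≤ dyadicRatio ν α n := by
  rw [dyadicRatio, dyadicRatio, EReal.coe_le_coe_iff]
  exact div_le_div_of_nonneg_right
    (Real.posLog_le_posLog (Nat.cast_nonneg _) (Nat.cast_le.2 (dyadicCount_mono hle α n)))
    (Real.log_nonneg (one_le_pow₀ one_le_two))

theorem dyadicRatio_le_iff {n : ℕ} (hn : n ≠ 0) (hρ : 0 ≤ ρ) :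
    dyadicRatio ν α n ≤ ρ ↔ (dyadicCount ν α n : ℝ) ≤ 2 ^ (ρ * n) := by
  have hn0 : (0 : ℝ) < n := by positivity
  have hpow : (1 : ℝ) ≤ 2 ^ (ρ * n) := Real.one_le_rpow one_le_two (by positivity)
  rw [dyadicRatio_eq, EReal.coe_le_coe_iff,
    div_le_iff₀ (mul_pos hn0 (Real.log_pos one_lt_two)), ← mul_assoc, ← Real.log_rpow two_pos]
  rcases (dyadicCount ν α n).eq_zero_or_pos with h0 | h0
  · rw [h0, Nat.cast_zero, Real.log_zero]
    exact iff_of_true (Real.log_nonneg hpow) (by positivity)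
  · exact Real.log_le_log_iff (Nat.cast_pos.2 h0) (by positivity)

theorem eventually_dyadicCount_le (hρ : 0 ≤ ρ) (h : limsup (dyadicRatio ν α) atTop < ρ) :
    ∀ᶠ n : ℕ in atTop, (dyadicCount ν α n : ℝ) ≤ 2 ^ (ρ * n) := by
  filter_upwards [eventually_lt_of_limsup_lt h, eventually_ne_atTop 0] with n hn hn0
  exact (dyadicRatio_le_iff hn0 hρ).1 hn.le

theorem limsup_dyadicRatio_le (hρ : 0 ≤ ρ)
    (h : ∀ᶠ n : ℕ in atTop, (dyadicCount ν α n : ℝ) ≤ K * 2 ^ (ρ * n)) :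
    limsup (dyadicRatio ν α) atTop ≤ ρ := by
  refine EReal.le_of_forall_lt_iff_le.1 fun ρ' hρ' => limsup_le_of_le (by isBoundedDefault) ?_
  rw [EReal.coe_lt_coe_iff] at hρ'
  have htend : Tendsto (fun n : ℕ => (2 : ℝ) ^ ((ρ' - ρ) * n)) atTop atTop :=
    (tendsto_rpow_atTop_of_base_gt_one 2 one_lt_two).comp
      (tendsto_natCast_atTop_atTop.const_mul_atTop (sub_pos.2 hρ'))
  filter_upwards [h, htend.eventually_ge_atTop K, eventually_ne_atTop 0] with n hn hK hn0
  rw [dyadicRatio_le_iff hn0 (hρ.trans hρ'.le)]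
  calc (dyadicCount ν α n : ℝ) ≤ K * 2 ^ (ρ * n) := hn
    _ ≤ 2 ^ ((ρ' - ρ) * n) * 2 ^ (ρ * n) := by gcongr
    _ = 2 ^ (ρ' * n) := by rw [← Real.rpow_add two_pos]; ring_nf

theorem lowerMFDim_mono [IsFiniteMeasure ν] (hle : μ ≤ ν) : lowerMFDim μ ≤ lowerMFDim ν :=
  iSup₂_mono fun α hα => EReal.div_le_div_right_of_nonneg
    (EReal.coe_nonneg.2 (by linarith)) <|
      liminf_le_liminf (Eventually.of_forall fun n => dyadicRatio_mono hle α n)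
        (by isBoundedDefault) (by isBoundedDefault)

theorem lowerMFDim_le_upperMFDim (ν : Measure ℝ) : lowerMFDim ν ≤ upperMFDim ν :=
  iSup₂_mono fun α hα => EReal.div_le_div_right_of_nonneg
    (EReal.coe_nonneg.2 (by linarith)) <|
      liminf_le_limsup (by isBoundedDefault) (by isBoundedDefault)

theorem upperMFDim_nonneg (ν : Measure ℝ) : 0 ≤ upperMFDim ν :=
  le_iSup₂_of_le 1 one_pos <| EReal.div_nonneg
    (le_limsup_of_frequently_le (Frequently.of_forall fun n => dyadicRatio_nonneg ν 1 n)
      (by isBoundedDefault))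
    (EReal.coe_nonneg.2 (by norm_num))

theorem limsup_dyadicRatio_le_of_upperSpectralDim_lt [IsFiniteMeasure ν] {r : ℝ} (hα : 0 < α)
    (hr0 : 0 ≤ r) (hr : upperSpectralDim ν < r) :
    limsup (dyadicRatio ν α) atTop ≤ ((r * (1 + α) : ℝ) : EReal) := by
  have hα1 : 0 < 1 + α := by linarith
  have htend : Tendsto (fun n : ℕ => 2 * (2 : ℝ) ^ ((1 + α) * n)) atTop atTop :=
    ((tendsto_rpow_atTop_of_base_gt_one _ one_lt_two).comp
      (tendsto_natCast_atTop_atTop.const_mul_atTop hα1)).const_mul_atTop two_pos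
  refine limsup_dyadicRatio_le (K := 2 + 3 * 2 ^ r) (by positivity) ?_
  filter_upwards [htend.eventually (eventually_le_rpow_of_limsup_lt hr)] with n hn
  have hcount : ENNReal.ofReal (dyadicCount ν α n) ≤
      ENNReal.ofReal (2 + 3 * (2 * 2 ^ ((1 + α) * n)) ^ r) := by
    calc ENNReal.ofReal (dyadicCount ν α n)
        = ((dyadicCount ν α n : ℕ∞) : ℝ≥0∞) := by simp
      _ ≤ ((2 + 3 * eigenvalueCount ν (2 * 2 ^ ((1 + α) * n)) : ℕ∞) : ℝ≥0∞) := by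
          exact_mod_cast dyadicCount_le_eigenvalueCount ν α n
      _ = 2 + 3 * (eigenvalueCount ν (2 * 2 ^ ((1 + α) * n)) : ℝ≥0∞) := by push_cast; rfl
      _ ≤ 2 + 3 * ENNReal.ofReal ((2 * 2 ^ ((1 + α) * n)) ^ r) := by gcongr
      _ = _ := by
          rw [ENNReal.ofReal_add two_pos.le (by positivity), ENNReal.ofReal_mul three_pos.le,
            ENNReal.ofReal_ofNat, ENNReal.ofReal_ofNat]
  have hpow : (1 : ℝ) ≤ 2 ^ (r * (1 + α) * n) := Real.one_le_rpow one_le_two (by positivity)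
  calc (dyadicCount ν α n : ℝ) ≤ 2 + 3 * (2 * 2 ^ ((1 + α) * n)) ^ r :=
        (ENNReal.ofReal_le_ofReal_iff (by positivity)).1 hcount
    _ = 2 + 3 * (2 ^ r * 2 ^ (r * (1 + α) * n)) := by
        rw [Real.mul_rpow two_pos.le (by positivity), ← Real.rpow_mul two_pos.le]
        ring_nf
    _ ≤ (2 + 3 * 2 ^ r) * 2 ^ (r * (1 + α) * n) := by linarith

theorem upperMFDim_le_max_upperSpectralDim [IsFiniteMeasure ν] :
    upperMFDim ν ≤ max (upperSpectralDim ν) 0 := by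
  refine iSup₂_le fun α hα => EReal.le_of_forall_lt_iff_le.1 fun r hr => ?_
  rw [max_lt_iff] at hr
  rw [EReal.div_le_iff_le_mul (EReal.coe_pos.2 (by linarith)) (EReal.coe_ne_top _),
    mul_comm, ← EReal.coe_mul]
  exact limsup_dyadicRatio_le_of_upperSpectralDim_lt hα (EReal.coe_nonneg.1 hr.2.le) hr.1

end MFDim

section FinePartition

variable {ν : Measure ℝ} {t u v w x : ℝ} {n n' : ℕ}

/-- The interval `(u, v]` has a partition into `n` half-open intervals `C` with `ν(C) Λ(C) < t`.
In contrast to `IsNuPartition`, atoms of `ν` are allowed as endpoints. -/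
def HasFinePartition (ν : Measure ℝ) (t u v : ℝ) (n : ℕ) : Prop :=
  ∃ c : ℕ → ℝ, c 0 = u ∧ c n = v ∧
    ∀ k < n, c k < c (k + 1) ∧ ν.real (Ioc (c k) (c (k + 1))) * (c (k + 1) - c k) < t

theorem HasFinePartition.single (huv : u < v) (h : ν.real (Ioc u v) * (v - u) < t) :
    HasFinePartition ν t u v 1 := by
  refine ⟨fun k => if k = 0 then u else v, rfl, rfl, fun k hk => ?_⟩
  obtain rfl : k = 0 := Nat.lt_one_iff.1 hk
  exact ⟨huv, h⟩

theorem HasFinePartition.append (h : HasFinePartition ν t u v n)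
    (h' : HasFinePartition ν t v w n') : HasFinePartition ν t u w (n + n') := by
  obtain ⟨c, hu, hv, hc⟩ := h
  obtain ⟨c', hv', hw, hc'⟩ := h'
  let e : ℕ → ℝ := fun k => if k ≤ n then c k else c' (k - n)
  have hleft {k : ℕ} (hk : k ≤ n) : e k = c k := if_pos hk
  have hright {k : ℕ} (hk : n ≤ k) : e k = c' (k - n) := by
    rcases hk.eq_or_lt with rfl | hk
    · rw [hleft le_rfl, hv, Nat.sub_self, hv']
    · exact if_neg hk.not_ge
  refine ⟨e, (hleft n.zero_le).trans hu, ?_, fun k hk => ?_⟩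
  · rw [hright (n.le_add_right n'), Nat.add_sub_cancel_left, hw]
  · rcases lt_or_ge k n with hkn | hkn
    · rw [hleft hkn.le, hleft hkn]
      exact hc k hkn
    · rw [hright hkn, hright (k := k + 1) (Nat.le_succ_of_le hkn), Nat.sub_add_comm hkn]
      exact hc' (k - n) (Nat.sub_lt_left_of_lt_add hkn hk)

theorem tendsto_measureReal_Ioc_add [IsFiniteMeasure ν] (a b : ℝ) :
    Tendsto (fun ε => ν.real (Ioc a (b + ε))) (𝓝[>] 0) (𝓝 (ν.real (Ioc a b))) := by
  have hinter : ⋂ ε > (0 : ℝ), Ioc a (b + ε) = Ioc a b := by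
    ext x
    simp only [mem_iInter, mem_Ioc]
    exact ⟨fun hx => ⟨(hx 1 one_pos).1, le_of_forall_pos_le_add fun ε hε => (hx ε hε).2⟩,
      fun hx ε hε => ⟨hx.1, by linarith [hx.2]⟩⟩
  have h := tendsto_measure_biInter_gt (μ := ν) (s := fun ε : ℝ => Ioc a (b + ε)) (a := 0)
    (fun _ _ => measurableSet_Ioc.nullMeasurableSet)
    (fun _ _ _ hij => Ioc_subset_Ioc_right (by linarith)) ⟨1, one_pos, measure_ne_top _ _⟩
  rw [hinter] at h
  exact (ENNReal.tendsto_toReal (measure_ne_top _ _)).comp h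

theorem eventually_measureReal_Ioc_add_mul_lt [IsFiniteMeasure ν]
    (h : ν.real (Ioc u v) * (v - u) < t) :
    ∀ᶠ ε in 𝓝[>] (0 : ℝ), ν.real (Ioc u (v + ε)) * (v + ε - u) < t := by
  have hlen : Tendsto (fun ε : ℝ => v + ε - u) (𝓝[>] 0) (𝓝 (v - u)) := by
    have : Continuous fun ε : ℝ => v + ε - u := by fun_prop
    simpa only [add_zero] using (this.tendsto 0).mono_left nhdsWithin_le_nhds
  exact ((tendsto_measureReal_Ioc_add u v).mul hlen).eventually_lt_const h

theorem exists_shift_avoiding_atoms [IsFiniteMeasure ν] {c : ℕ → ℝ}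
    (hc : ∀ k < n, c k < c (k + 1) ∧ ν.real (Ioc (c k) (c (k + 1))) * (c (k + 1) - c k) < t) :
    ∃ ε > 0, (∀ k, ν {c k + ε} = 0) ∧ ∀ k < n, ε < c (k + 1) - c k ∧
      ν.real (Ioc (c k) (c (k + 1) + ε)) * (c (k + 1) + ε - c k) < t := by
  have hsmall : ∀ᶠ ε in 𝓝[>] (0 : ℝ), ∀ k ∈ Finset.range n, ε < c (k + 1) - c k ∧
      ν.real (Ioc (c k) (c (k + 1) + ε)) * (c (k + 1) + ε - c k) < t := by
    refine (Filter.eventually_all_finset _).2 fun k hk => ?_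
    obtain ⟨hlt, hfine⟩ := hc k (Finset.mem_range.1 hk)
    exact (Eventually.filter_mono nhdsWithin_le_nhds (eventually_lt_nhds (sub_pos.2 hlt))).and
      (eventually_measureReal_Ioc_add_mul_lt hfine)
  obtain ⟨δ, hδ, hsub⟩ := mem_nhdsGT_iff_exists_Ioo_subset.1 hsmall
  obtain ⟨ε, hε, hatom⟩ := exists_mem_Ioo_forall_measure_singleton_eq_zero ν
    (φ := fun k ε => c k + ε) (fun k => add_right_injective (c k)) hδ
  exact ⟨ε, hε.1, hatom, fun k hk => hsub hε k (Finset.mem_range.2 hk)⟩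

-- The interior endpoints are moved to the right by a common small `ε` avoiding the atoms of `ν`.
theorem HasFinePartition.partitionCount_le [IsFiniteMeasure ν] (hν : ν (Ioo 0 1)ᶜ = 0)
    (h : HasFinePartition ν (1 / x) 0 1 n) : partitionCount ν x ≤ n := by
  obtain ⟨c, h0, h1, hc⟩ := h
  obtain ⟨ε, hε, hatom, hfine⟩ := exists_shift_avoiding_atoms hc
  let s : ℕ → ℝ := (Ioo 0 n).indicator fun _ => ε
  have hs_nonneg (k : ℕ) : 0 ≤ s k := indicator_nonneg (fun _ _ => hε.le) k
  have hs_le (k : ℕ) : s k ≤ ε := indicator_le_self' (fun _ _ => hε.le) k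
  have hs_zero : c 0 + s 0 = 0 := by simp [s, h0]
  have hs_last : c n + s n = 1 := by simp [s, h1]
  have hend {y : ℝ} (hy : y ∉ Ioo (0 : ℝ) 1) : ν {y} = 0 :=
    measure_mono_null (singleton_subset_iff.2 hy) hν
  have hs_atom (k : ℕ) (hk : k ≤ n) : ν {c k + s k} = 0 := by
    by_cases hmem : k ∈ Ioo 0 n
    · rw [show s k = ε from indicator_of_mem hmem _]
      exact hatom k
    · obtain rfl | rfl : k = 0 ∨ k = n := by rw [mem_Ioo] at hmem; omega
      · exact hend (by simp [hs_zero])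
      · exact hend (by simp [hs_last])
  refine iInf₂_le n ⟨fun i => c i + s i, ⟨Fin.strictMono_iff_lt_succ.2 fun k => ?_,
    hs_zero, hs_last, fun k => hs_atom k (Fin.is_le k)⟩, fun k => ?_⟩
  all_goals
    obtain ⟨hgap, hsmall⟩ := hfine k k.2
    simp only [Fin.val_castSucc, Fin.val_succ]
  · linarith [hs_le k, hs_nonneg (k + 1)]
  · exact (mul_le_mul
      (measureReal_mono
        (Ioc_subset_Ioc (by linarith [hs_nonneg k]) (by linarith [hs_le (k + 1)])))
      (by linarith [hs_nonneg k, hs_le (k + 1)]) (by linarith [hs_le k, hs_nonneg (k + 1)])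
      measureReal_nonneg).trans_lt hsmall

end FinePartition

section DyadicStopping

variable {ν : Measure ℝ} {t x : ℝ} {n k : ℕ}

theorem hasFinePartition_one_of_dyadicIoc (h : ν.real (dyadicIoc n k) < t * 2 ^ n) :
    HasFinePartition ν t ((k : ℝ) / 2 ^ n) (((k : ℝ) + 1) / 2 ^ n) 1 := by
  have hn : (0 : ℝ) < 2 ^ n := by positivity
  refine HasFinePartition.single (div_lt_div_of_pos_right (lt_add_one _) hn) ?_
  rw [← sub_div, add_sub_cancel_left, mul_one_div, div_lt_iff₀ hn]
  exact h

open Classical in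
/-- The indices of those dyadic intervals `C` of order `n + i` contained in the `k`-th dyadic
interval of order `n` which satisfy `ν(C) Λ(C) ≥ t`. -/
noncomputable def heavyDescendants (ν : Measure ℝ) (t : ℝ) (n k i : ℕ) : Finset ℕ :=
  {j ∈ Finset.Ico (k * 2 ^ i) ((k + 1) * 2 ^ i) | t * 2 ^ (n + i) ≤ ν.real (dyadicIoc (n + i) j)}

theorem heavyDescendants_root (ν : Measure ℝ) (t : ℝ) (i : ℕ) :
    heavyDescendants ν t 0 0 i = heavy ν (t * 2 ^ i) i := by
  rw [heavyDescendants, heavy, zero_add, zero_mul, zero_add, one_mul, Finset.range_eq_Ico]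

theorem card_heavyDescendants_zero (h : t * 2 ^ n ≤ ν.real (dyadicIoc n k)) :
    (heavyDescendants ν t n k 0).card = 1 := by
  rw [heavyDescendants, pow_zero, mul_one, mul_one, Nat.Ico_succ_singleton,
    Finset.filter_singleton, add_zero, if_pos h, Finset.card_singleton]

theorem card_heavyDescendants_succ (ν : Measure ℝ) (t : ℝ) (n k i : ℕ) :
    (heavyDescendants ν t n k (i + 1)).card = (heavyDescendants ν t (n + 1) (2 * k) i).card +
      (heavyDescendants ν t (n + 1) (2 * k + 1) i).card := by
  have hsplit : Finset.Ico (k * 2 ^ (i + 1)) ((k + 1) * 2 ^ (i + 1)) =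
      Finset.Ico (2 * k * 2 ^ i) ((2 * k + 1) * 2 ^ i) ∪
        Finset.Ico ((2 * k + 1) * 2 ^ i) ((2 * k + 1 + 1) * 2 ^ i) := by
    rw [Finset.Ico_union_Ico_eq_Ico (Nat.mul_le_mul_right _ (Nat.le_add_right _ 1))
      (Nat.mul_le_mul_right _ (Nat.le_add_right _ 1))]
    congr 1 <;> ring
  simp only [heavyDescendants]
  rw [hsplit, Finset.filter_union, Finset.card_union_of_disjoint
    (Finset.disjoint_filter_filter (Finset.Ico_disjoint_Ico_consecutive _ _ _)),
    show n + (i + 1) = n + 1 + i by ring]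

-- A dyadic interval `C` is split as long as `ν(C) Λ(C) ≥ t`, and every splitting increases the
-- number of intervals by one.
theorem exists_hasFinePartition_dyadic (d n k : ℕ)
    (hd : ∀ j, ν.real (dyadicIoc (n + d) j) < t * 2 ^ (n + d)) :
    ∃ N ≤ 1 + ∑ i ∈ Finset.range d, (heavyDescendants ν t n k i).card,
      HasFinePartition ν t ((k : ℝ) / 2 ^ n) (((k : ℝ) + 1) / 2 ^ n) N := by
  induction d generalizing n k with
  | zero => exact ⟨1, Nat.le_add_right _ _, hasFinePartition_one_of_dyadicIoc (hd k)⟩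
  | succ d ih =>
    rcases lt_or_ge (ν.real (dyadicIoc n k)) (t * 2 ^ n) with hlight | hheavy
    · exact ⟨1, Nat.le_add_right _ _, hasFinePartition_one_of_dyadicIoc hlight⟩
    rw [← add_assoc, add_right_comm] at hd
    obtain ⟨N₁, hN₁, hleft⟩ := ih (n + 1) (2 * k) hd
    obtain ⟨N₂, hN₂, hright⟩ := ih (n + 1) (2 * k + 1) hd
    refine ⟨N₁ + N₂, ?_, ?_⟩
    · rw [Finset.sum_range_succ', card_heavyDescendants_zero hheavy]
      simp only [card_heavyDescendants_succ, Finset.sum_add_distrib]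
      omega
    · convert hleft.append (w := ((k : ℝ) + 1) / 2 ^ n) ?_ using 1
      · push_cast
        field_simp
        ring
      · convert hright using 1 <;> push_cast
        · rfl
        · field_simp
          ring

theorem partitionCount_le_sum_card_heavy [IsFiniteMeasure ν] (hν : ν (Ioo 0 1)ᶜ = 0) (hx : 0 < x)
    {d : ℕ} (hd : ν.real univ * x < 2 ^ d) :
    partitionCount ν x ≤ (1 + ∑ i ∈ Finset.range d, (heavy ν (2 ^ i / x) i).card : ℕ) := by
  have hlight (j : ℕ) : ν.real (dyadicIoc (0 + d) j) < 1 / x * 2 ^ (0 + d) := by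
    rw [zero_add, one_div_mul_eq_div, lt_div_iff₀ hx]
    exact (mul_le_mul_of_nonneg_right (measureReal_mono (subset_univ _)) hx.le).trans_lt hd
  obtain ⟨N, hN, hpart⟩ := exists_hasFinePartition_dyadic d 0 0 hlight
  simp only [heavyDescendants_root, one_div_mul_eq_div] at hN
  rw [Nat.cast_zero, zero_div, zero_add, pow_zero, div_one] at hpart
  exact (hpart.partitionCount_le hν).trans (Nat.cast_le.2 hN)

end DyadicStopping

section UniformCounting

variable {ν : Measure ℝ} {r : ℝ}

theorem dyadicCount_le_two_pow (ν : Measure ℝ) (α : ℝ) (n : ℕ) : dyadicCount ν α n ≤ 2 ^ n := by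
  rw [dyadicCount_eq_card_heavy]
  exact card_heavy_le_two_pow _ _ _

theorem dyadicCount_le_dyadicCount (ν : Measure ℝ) {α β : ℝ} (h : α ≤ β) (n : ℕ) :
    dyadicCount ν α n ≤ dyadicCount ν β n := by
  simp only [dyadicCount_eq_card_heavy]
  exact Finset.card_le_card <| heavy_anti ν (Real.rpow_le_rpow_of_exponent_le one_le_two
    (mul_le_mul_of_nonneg_right (neg_le_neg h) n.cast_nonneg)) n

theorem eventually_dyadicCount_le_of_upperMFDim_lt (h : upperMFDim ν < r) {α : ℝ} (hα : 0 < α) :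
    ∀ᶠ n : ℕ in atTop, (dyadicCount ν α n : ℝ) ≤ 2 ^ (r * (1 + α) * n) := by
  have hr : 0 < r := EReal.coe_pos.1 ((upperMFDim_nonneg ν).trans_lt h)
  refine eventually_dyadicCount_le (by positivity) ?_
  have hlt : limsup (dyadicRatio ν α) atTop / ((1 + α : ℝ) : EReal) < r :=
    (le_iSup₂ (f := fun (α : ℝ) (_ : 0 < α) =>
      limsup (dyadicRatio ν α) atTop / ((1 + α : ℝ) : EReal)) α hα).trans_lt h
  rwa [EReal.div_lt_iff (EReal.coe_pos.2 (by linarith)) (EReal.coe_ne_top _),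
    ← EReal.coe_mul] at hlt

-- For `α` below `1 / s` it is enough to consider a grid of finitely many exponents; for larger `α`
-- the bound `dyadicCount ν α n ≤ 2 ^ n` is good enough.
theorem eventually_forall_dyadicCount_le (h : upperMFDim ν < r) :
    ∀ᶠ n : ℕ in atTop, ∀ α ≥ 0, (dyadicCount ν α n : ℝ) ≤ 2 ^ (r * (1 + α) * n) := by
  obtain ⟨s, hs, hsr⟩ := EReal.lt_iff_exists_real_btwn.1 h
  have hs0 : 0 < s := EReal.coe_pos.1 ((upperMFDim_nonneg ν).trans_lt hs)
  rw [EReal.coe_lt_coe_iff] at hsr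
  set δ := r / s - 1 with hδ
  have hδ0 : 0 < δ := sub_pos.2 ((one_lt_div hs0).2 hsr)
  have hr : r = s * (1 + δ) := by rw [hδ]; field_simp; ring
  have hgrid : ∀ᶠ n : ℕ in atTop, ∀ j ∈ Finset.range (⌊s⁻¹ / δ⌋₊ + 1),
      (dyadicCount ν ((j + 1) * δ) n : ℝ) ≤ 2 ^ (s * (1 + (j + 1) * δ) * n) :=
    (Filter.eventually_all_finset _).2 fun j _ =>
      eventually_dyadicCount_le_of_upperMFDim_lt hs (by positivity)
  filter_upwards [hgrid] with n hn α hα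
  rcases le_or_gt s⁻¹ α with hlarge | hsmall
  · calc (dyadicCount ν α n : ℝ) ≤ 2 ^ (1 * (n : ℝ)) := by
          rw [one_mul, Real.rpow_natCast]
          exact_mod_cast dyadicCount_le_two_pow ν α n
      _ ≤ 2 ^ (r * (1 + α) * n) := by
          have : 1 ≤ s * α := (inv_le_iff_one_le_mul₀' hs0).1 hlarge
          gcongr
          · exact one_le_two
          · nlinarith
  · have hαj : α ≤ (⌊α / δ⌋₊ + 1) * δ := ((div_lt_iff₀ hδ0).1 (Nat.lt_floor_add_one _)).le
    have hjα : (⌊α / δ⌋₊ : ℝ) * δ ≤ α := (le_div_iff₀ hδ0).1 (Nat.floor_le (by positivity))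
    calc (dyadicCount ν α n : ℝ) ≤ dyadicCount ν ((⌊α / δ⌋₊ + 1) * δ) n :=
          Nat.cast_le.2 (dyadicCount_le_dyadicCount ν hαj n)
      _ ≤ 2 ^ (s * (1 + (⌊α / δ⌋₊ + 1) * δ) * n) :=
          hn _ (Finset.mem_range.2 (Nat.lt_succ_of_le (Nat.floor_mono (by gcongr))))
      _ ≤ 2 ^ (r * (1 + α) * n) := by
          have : s * (1 + (⌊α / δ⌋₊ + 1) * δ) ≤ r * (1 + α) := by
            rw [hr, mul_assoc]
            exact mul_le_mul_of_nonneg_left (by linarith [mul_nonneg hδ0.le hα]) hs0.le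
          gcongr
          exact one_le_two

-- The threshold `2 ^ n / x` is at least `2 ^ (-α * n)` for `α = max 0 (log₂ x / n - 1)`.
theorem eventually_forall_card_heavy_le (h : upperMFDim ν < r) :
    ∀ᶠ n : ℕ in atTop, ∀ x > 0, ((heavy ν (2 ^ n / x) n).card : ℝ) ≤ max (2 ^ n) x ^ r := by
  filter_upwards [eventually_forall_dyadicCount_le h, eventually_gt_atTop 0] with n hn hn0 x hx
  have hn0 : (0 : ℝ) < n := Nat.cast_pos.2 hn0
  set y := Real.logb 2 (max (2 ^ n) x)
  have hmax : (2 : ℝ) ^ y = max (2 ^ n) x :=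
    Real.rpow_logb two_pos one_lt_two.ne' (lt_max_of_lt_right hx)
  have hny : n ≤ y := by
    rw [← Real.rpow_le_rpow_left_iff one_lt_two, hmax, Real.rpow_natCast]
    exact le_max_left _ _
  have hy : (1 + (y / n - 1)) * n = y := by field_simp; ring
  have hthreshold : (2 : ℝ) ^ (-(y / n - 1) * n) ≤ 2 ^ n / x := by
    calc (2 : ℝ) ^ (-(y / n - 1) * n) = 2 ^ ((n : ℝ) - y) := by congr 1; linarith
      _ = 2 ^ n / max (2 ^ n) x := by rw [Real.rpow_sub two_pos, hmax, Real.rpow_natCast]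
      _ ≤ 2 ^ n / x := div_le_div_of_nonneg_left (by positivity) hx (le_max_right _ _)
  calc ((heavy ν (2 ^ n / x) n).card : ℝ) ≤ dyadicCount ν (y / n - 1) n := by
        rw [dyadicCount_eq_card_heavy]
        exact Nat.cast_le.2 (Finset.card_le_card (heavy_anti ν hthreshold n))
    _ ≤ 2 ^ (r * (1 + (y / n - 1)) * n) := hn _ (sub_nonneg.2 ((one_le_div hn0).2 hny))
    _ = max (2 ^ n) x ^ r := by rw [mul_assoc, hy, mul_comm, Real.rpow_mul two_pos.le, hmax]

theorem exists_forall_card_heavy_le (h : upperMFDim ν < r) :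
    ∃ K > 0, ∀ (n : ℕ), ∀ x > 0,
      ((heavy ν (2 ^ n / x) n).card : ℝ) ≤ K * max (2 ^ n) x ^ r := by
  have hr : 0 ≤ r := EReal.coe_nonneg.1 ((upperMFDim_nonneg ν).trans h.le)
  obtain ⟨n₀, hn₀⟩ := eventually_atTop.1 (eventually_forall_card_heavy_le h)
  refine ⟨2 ^ n₀, by positivity, fun n x hx => ?_⟩
  rcases le_total n₀ n with hn | hn
  · exact (hn₀ n hn x hx).trans
      (le_mul_of_one_le_left (by positivity) (one_le_pow₀ one_le_two))
  · calc ((heavy ν (2 ^ n / x) n).card : ℝ) ≤ 2 ^ n :=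
          mod_cast card_heavy_le_two_pow ν (2 ^ n / x) n
      _ ≤ 2 ^ n₀ := pow_le_pow_right₀ one_le_two hn
      _ ≤ 2 ^ n₀ * max (2 ^ n) x ^ r := le_mul_of_one_le_right (by positivity)
          (Real.one_le_rpow (le_max_of_le_left (one_le_pow₀ one_le_two)) hr)

end UniformCounting

section Entropy

variable {ν : Measure ℝ} [IsFiniteMeasure ν] {r : ℝ}

theorem add_one_le_rpow_of_two_pow_le {ε x : ℝ} (hε : 0 < ε) {d : ℕ} (h : 2 ^ d ≤ x) :
    (d : ℝ) + 1 ≤ (1 / (ε * Real.log 2) + 1) * x ^ ε := by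
  have hlog2 := Real.log_pos one_lt_two
  have hx : 1 ≤ x := (one_le_pow₀ one_le_two).trans h
  have hd : d * Real.log 2 ≤ x ^ ε / ε := by
    rw [← Real.log_pow]
    exact (Real.log_le_log (by positivity) h).trans
      (Real.log_le_rpow_div (zero_le_one.trans hx) hε)
  rw [add_one_mul]
  refine add_le_add ?_ (Real.one_le_rpow hx hε.le)
  calc (d : ℝ) ≤ x ^ ε / ε / Real.log 2 := (le_div_iff₀ hlog2).2 hd
    _ = 1 / (ε * Real.log 2) * x ^ ε := by field_simp

theorem one_add_mul_rpow_le {s K M x : ℝ} (hs : 0 < s) (hsr : s < r) (hK : 0 ≤ K) (hM : 1 ≤ M)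
    (hx : 1 ≤ x) {d : ℕ} (hd : (2 : ℝ) ^ d ≤ M * x) :
    1 + (d + 1) * (K * (M * x) ^ s) ≤
      (1 + (1 / ((r - s) * Real.log 2) + 1) * K * M ^ r) * x ^ r := by
  have hM0 : 0 < M := zero_lt_one.trans_le hM
  have hx0 : 0 < x := zero_lt_one.trans_le hx
  set L := 1 / ((r - s) * Real.log 2) + 1
  calc 1 + (d + 1) * (K * (M * x) ^ s)
      ≤ x ^ r + L * (M * x) ^ (r - s) * (K * (M * x) ^ s) := by
        gcongr
        · exact Real.one_le_rpow hx (hs.trans hsr).le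
        · exact add_one_le_rpow_of_two_pow_le (sub_pos.2 hsr) hd
    _ = x ^ r + L * K * ((M * x) ^ (r - s) * (M * x) ^ s) := by ring
    _ = (1 + L * K * M ^ r) * x ^ r := by
        rw [← Real.rpow_add (mul_pos hM0 hx0), sub_add_cancel, Real.mul_rpow hM0.le hx0.le]
        ring

theorem exists_forall_partitionCount_le (hν : ν (Ioo 0 1)ᶜ = 0) (h : upperMFDim ν < r) :
    ∃ C : ℝ, ∀ x ≥ 1, (partitionCount ν x : ℝ≥0∞) ≤ ENNReal.ofReal (C * x ^ r) := by
  obtain ⟨s, hs, hsr⟩ := EReal.lt_iff_exists_real_btwn.1 h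
  have hs0 : 0 < s := EReal.coe_pos.1 ((upperMFDim_nonneg ν).trans_lt hs)
  rw [EReal.coe_lt_coe_iff] at hsr
  obtain ⟨K, hK, hheavy⟩ := exists_forall_card_heavy_le hs
  set M := max (ν.real univ) 1
  have hM : 1 ≤ M := le_max_right _ _
  set C := 1 + (1 / ((r - s) * Real.log 2) + 1) * K * M ^ r
  refine ⟨C, fun x hx => ?_⟩
  have hx0 : 0 < x := zero_lt_one.trans_le hx
  have hxM : x ≤ M * x := le_mul_of_one_le_left hx0.le hM
  obtain ⟨d, hd, hd'⟩ := exists_nat_pow_near (hx.trans hxM) one_lt_two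
  have hterm : ∀ i ∈ Finset.range (d + 1),
      ((heavy ν (2 ^ i / x) i).card : ℝ) ≤ K * (M * x) ^ s := fun i hi => by
    have : (2 : ℝ) ^ i ≤ M * x :=
      (pow_le_pow_right₀ one_le_two (Nat.lt_succ_iff.1 (Finset.mem_range.1 hi))).trans hd
    refine (hheavy i x hx0).trans ?_
    gcongr
    exact max_le this hxM
  have hsum : ((1 + ∑ i ∈ Finset.range (d + 1), (heavy ν (2 ^ i / x) i).card : ℕ) : ℝ) ≤
      C * x ^ r := by
    refine le_trans ?_ (one_add_mul_rpow_le hs0 hsr hK.le hM hx hd)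
    push_cast
    gcongr
    simpa using Finset.sum_le_card_nsmul _ _ _ hterm
  calc (partitionCount ν x : ℝ≥0∞)
      ≤ ((1 + ∑ i ∈ Finset.range (d + 1), (heavy ν (2 ^ i / x) i).card : ℕ) : ℝ≥0∞) :=
        ENat.toENNReal_le.2 <| partitionCount_le_sum_card_heavy hν hx0 <|
          (mul_le_mul_of_nonneg_right (le_max_left _ _) hx0.le).trans_lt hd'
    _ ≤ ENNReal.ofReal (C * x ^ r) := by
        rw [← ENNReal.ofReal_natCast]
        exact ENNReal.ofReal_le_ofReal hsum

theorem upperEntropy_le_upperMFDim (hν : ν (Ioo 0 1)ᶜ = 0) : upperEntropy ν ≤ upperMFDim ν := by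
  refine EReal.le_of_forall_lt_iff_le.1 fun r hr => ?_
  obtain ⟨C, hC⟩ := exists_forall_partitionCount_le hν hr
  exact limsup_logRatio_le C ((eventually_ge_atTop 1).mono hC)

end Entropy

section Regularity

variable {μ ν : Measure ℝ} [IsFiniteMeasure μ]

theorem IsRegular.of_le (hr : IsRegular ν) (hle : ν ≤ μ) (hμ : μ (Ioo 0 1)ᶜ = 0)
    (hs : upperSpectralDim μ ≤ upperSpectralDim ν) : IsRegular μ := by
  have : IsFiniteMeasure ν := isFiniteMeasure_of_le μ hle
  apply le_antisymm
  · exact iSup₂_le fun m hm => (lowerReducedEntropy_le_lowerSpectralDim hm).trans <|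
      (lowerSpectralDim_le_upperSpectralDim μ).trans upperSpectralDim_le_upperEntropy
  · calc upperEntropy μ ≤ upperMFDim μ := upperEntropy_le_upperMFDim hμ
      _ ≤ max (upperSpectralDim μ) 0 := upperMFDim_le_max_upperSpectralDim
      _ ≤ upperEntropy ν :=
        max_le (hs.trans upperSpectralDim_le_upperEntropy) (upperEntropy_nonneg ν)
      _ = ⨆ (m : ℝ) (_ : 1 < m), lowerReducedEntropy ν m := hr.symm
      _ ≤ ⨆ (m : ℝ) (_ : 1 < m), lowerReducedEntropy μ m := iSup_lowerReducedEntropy_mono hle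

theorem IsMFRegular.of_le (hr : IsMFRegular ν) (hle : ν ≤ μ) (hμ : μ (Ioo 0 1)ᶜ = 0)
    (hs : upperSpectralDim μ ≤ upperSpectralDim ν) : IsMFRegular μ := by
  have : IsFiniteMeasure ν := isFiniteMeasure_of_le μ hle
  have hν : ν (Ioo 0 1)ᶜ = 0 := le_antisymm ((hle _).trans_eq hμ) zero_le
  refine le_antisymm (lowerMFDim_le_upperMFDim μ) ?_
  calc upperMFDim μ ≤ max (upperSpectralDim μ) 0 := upperMFDim_le_max_upperSpectralDim
    _ ≤ upperMFDim ν := max_le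
        (hs.trans (upperSpectralDim_le_upperEntropy.trans (upperEntropy_le_upperMFDim hν)))
        (upperMFDim_nonneg ν)
    _ = lowerMFDim ν := hr.symm
    _ ≤ lowerMFDim μ := lowerMFDim_mono hle

end Regularity

end KreinFeller

theorem corollary1p9 (ν₁ ν₂ : MeasureTheory.Measure ℝ)
    [MeasureTheory.IsFiniteMeasure ν₁] [MeasureTheory.IsFiniteMeasure ν₂]
    (hν₁ : ν₁ (Set.Ioo 0 1)ᶜ = 0) (hν₂ : ν₂ (Set.Ioo 0 1)ᶜ = 0) :
    KreinFeller.upperSpectralDim (ν₁ + ν₂) =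
        max (KreinFeller.upperSpectralDim ν₁) (KreinFeller.upperSpectralDim ν₂) ∧
    (KreinFeller.lowerSpectralDim ν₁ = KreinFeller.upperSpectralDim ν₁ →
      KreinFeller.upperSpectralDim ν₂ ≤ KreinFeller.upperSpectralDim ν₁ →
        (KreinFeller.lowerSpectralDim (ν₁ + ν₂) = KreinFeller.upperSpectralDim ν₁ ∧
          KreinFeller.upperSpectralDim (ν₁ + ν₂) = KreinFeller.upperSpectralDim ν₁) ∧
        (KreinFeller.IsRegular ν₁ → KreinFeller.IsRegular (ν₁ + ν₂)) ∧
        (KreinFeller.IsMFRegular ν₁ → KreinFeller.IsMFRegular (ν₁ + ν₂))) := by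
  have hν : (ν₁ + ν₂) (Ioo 0 1)ᶜ = 0 := by rw [Measure.add_apply, hν₁, hν₂, add_zero]
  have hle : ν₁ ≤ ν₁ + ν₂ := Measure.le_add_right le_rfl
  have hadd := KreinFeller.upperSpectralDim_add (μ := ν₁) (ν := ν₂)
  refine ⟨hadd, fun hdim h21 => ?_⟩
  have hup : KreinFeller.upperSpectralDim (ν₁ + ν₂) = KreinFeller.upperSpectralDim ν₁ := by
    rw [hadd, max_eq_left h21]
  have hlow : KreinFeller.lowerSpectralDim (ν₁ + ν₂) = KreinFeller.upperSpectralDim ν₁ :=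
    le_antisymm ((KreinFeller.lowerSpectralDim_le_upperSpectralDim _).trans_eq hup)
      (hdim.symm.le.trans (KreinFeller.lowerSpectralDim_mono hle))
  exact ⟨⟨hlow, hup⟩, fun hreg => hreg.of_le hle hν hup.le, fun hreg => hreg.of_le hle hν hup.le⟩
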